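/- Let $k \ge 2$. A hypergraph $(H,E)$, $E \subseteq H^k$, is \emph{$k$-full} if $E$ is closed under permutation on $k$-tuples of distinct vertices and contains every $k$-tuple with fewer than $k$ distinct entries. A \emph{template} of arity $k$ is a sequence $\mathcal H = \langle (H_n,E_n) : n<\omega\rangle$ of finite $k$-full hypergraphs, with vertex sets $H_n=\{0,\dots,|H_n|-1\}$, for which there is $f:\omega\to\omega\setminus\{0\}$ with $f(n)\to\infty$ and $f(n)\le |H_n|$ for all $n$, such that for every $n$ and any $f(n)$ many $(k-1)$-tuples $\bar i^{\,0},\dots,\bar i^{\,f(n)-1}$ from $H_n$ there is $s\in H_n$ with $\langle s\rangle^\smallfrown \bar i^{\,\ell}\in E_n$ for all $\ell<f(n)$. Let $X$ be the set of finite sequences $\eta$ with $\eta(n)\in H_n$ for all $n<\mathrm{lgn}(\eta)$. Let $T_0$ be the universal theory, in the language with equality, a $k$-place relation $R$ and unary predicates $Q_\eta$ ($\eta\in X$), stating that: $R$ is symmetric and holds only on $k$-tuples of distinct elements; $Q_{\langle\rangle}$ holds everywhere; $Q_\nu$ implies $Q_\eta$ when $\eta$ is an initial segment of $\nu$; the predicates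 $Q_{\eta^\smallfrown\langle i\rangle}$, $i \in H_{\mathrm{lgn}(\eta)}$, partition $Q_\eta$; and, whenever $\eta_0,\dots,\eta_{k-1}\in X$ have length $>n$ and $\langle\eta_0(n),\dots,\eta_{k-1}(n)\rangle\notin E_n$, no $R$-edge $(x_0,\dots,x_{k-1})$ satisfies $Q_{\eta_0}(x_0)\wedge\dots\wedge Q_{\eta_{k-1}}(x_{k-1})$. Then for every template $\mathcal H$ the theory $T_0$ has a model completion, and any model completion $T$ of $T_0$ is simple of rank $1$: (a) $T$ is simple, i.e. no formula $\varphi(\bar x,\bar y)$ has the tree property in a model of $T$; (b) $T$ has rank $1$, i.e. $1$ is the supremum of the $SU$-ranks of types in one variable over sets of parameters in models of $T$. Moreover, the only source of dividing is equality: let $M\models T$ and let $\varphi(\bar x,\bar y)$ be a formula. (c) If $\langle \bar a_i : i\in I\rangle$ is an indiscernible sequence in $M$ indexed by an infinite linear order and, for some $i_0$, $\varphi(\bar x,\bar a_{i_0})$ has a realization in $M$ none of whose entries is an entry of $\bar a_{i_0}$, then $\{\varphi(\bar x,\bar a_i): i\in I\}$ is consistent (finitely satisfiable in $M$). (d) If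 $\bar a$ is a tuple of $M$ and $\varphi(\bar x,\bar a)$ has a realization in $M$ none of whose entries is an entry of $\bar a$, then $\varphi(\bar x,\bar a)$ does not divide over any $A\subseteq M$. -/

import Mathlib

open FirstOrder FirstOrder.Language

/-! ### Model-theoretic notions -/

namespace ModelNotions

universe u v w

/-- `T'` is a model completion of `T`: it extends `T`, every model of `T` embeds into a model of
`T'`, and for every model `M` of `T` the theory `T'` together with the atomic diagram of `M` is
complete, i.e. any two models of `T'` into which `M` embeds satisfy the same first-order
formulas about the elements of `M`.  (Models are nonempty.) -/
structure IsModelCompletion {L : FirstOrder.Language.{u, v}} (T T' : L.Theory) : Prop where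
  extends_base : ∀ φ ∈ T, T' ⊨ᵇ φ
  embeds : ∀ M : Theory.ModelType.{u, v, max u v} T,
    ∃ N : Theory.ModelType.{u, v, max u v} T', Nonempty (M ↪[L] N)
  diagram_complete : ∀ (M : Theory.ModelType.{u, v, max u v} T)
    (N₁ N₂ : Theory.ModelType.{u, v, max u v} T') (f₁ : M ↪[L] N₁) (f₂ : M ↪[L] N₂)
    (φ : L.Formula M), φ.Realize f₁ ↔ φ.Realize f₂

section

variable {L : FirstOrder.Language.{u, v}}

/-- The tuples `s`, `t` of `M` have the same complete type over `A ⊆ M`. -/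
def SameTypeOver {M : Type w} [L.Structure M] {n : ℕ} (A : Set M) (s t : Fin n → M) : Prop :=
  ∀ φ : L.Formula (A ⊕ Fin n),
    φ.Realize (Sum.elim (fun c : A => (c : M)) s) ↔ φ.Realize (Sum.elim (fun c : A => (c : M)) t)

/-- The instance `φ(x̄, ā)` divides over `A`: for some `r` there are, in an elementary extension,
realizations `s 0, s 1, …` of `tp(ā/A)` such that `{φ(x̄, s i) : i < ω}` is `r`-inconsistent. -/
def Divides {M : Type w} [L.Structure M] {m n : ℕ} (A : Set M)
    (φ : L.Formula (Fin m ⊕ Fin n)) (a : Fin n → M) : Prop :=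
  ∃ (N : Type w) (_ : L.Structure N) (f : M ↪ₑ[L] N) (r : ℕ) (s : ℕ → Fin n → N),
    (∀ i, SameTypeOver (L := L) (f '' A) (s i) (f ∘ a)) ∧
    ∀ S : Finset ℕ, S.card = r →
      ¬ ∃ b : Fin m → N, ∀ i ∈ S, φ.Realize (Sum.elim b (s i))

/-- The instance `φ(x̄, ā)` forks over `A`: in an elementary extension it implies a finite
disjunction of instances of formulas each of which divides over `A`. -/
def Forks {M : Type w} [L.Structure M] {m n : ℕ} (A : Set M)
    (φ : L.Formula (Fin m ⊕ Fin n)) (a : Fin n → M) : Prop :=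
  ∃ (N : Type w) (_ : L.Structure N) (f : M ↪ₑ[L] N) (l : ℕ) (p : Fin l → ℕ)
    (ψ : ∀ i : Fin l, L.Formula (Fin m ⊕ Fin (p i))) (c : ∀ i : Fin l, Fin (p i) → N),
    (∀ i, Divides (f '' A) (ψ i) (c i)) ∧
    ∀ b : Fin m → N, φ.Realize (Sum.elim b (f ∘ a)) → ∃ i, (ψ i).Realize (Sum.elim b (c i))

/-- `tp(b/B)` forks over `A`: it contains an instance which forks over `A`. -/
def TypeForks (L : FirstOrder.Language.{u, v}) {M : Type w} [L.Structure M] {m : ℕ} (A B : Set M)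
    (b : Fin m → M) : Prop :=
  ∃ (n : ℕ) (φ : L.Formula (Fin m ⊕ Fin n)) (a : Fin n → M),
    (∀ i, a i ∈ B) ∧ φ.Realize (Sum.elim b a) ∧ Forks A φ a

/-- `SU(tp(b/A)) ≥ n`: always for `n = 0`; and `SU(tp(b/A)) ≥ n + 1` if, in some elementary
extension, `tp(b/A)` has a forking extension `tp(b/B)`, `A ⊆ B`, with `SU(tp(b/B)) ≥ n`. -/
def SURankGE (L : FirstOrder.Language.{u, v}) {m : ℕ} :
    ℕ → ∀ (M : Type w) [L.Structure M], Set M → (Fin m → M) → Prop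
  | 0, _, _, _, _ => True
  | n + 1, M, _, A, b =>
    ∃ (N : Type w) (_ : L.Structure N) (f : M ↪ₑ[L] N) (B : Set N),
      f '' A ⊆ B ∧ TypeForks L (f '' A) B (f ∘ b) ∧ SURankGE L n N B (f ∘ b)

/-- The theory `T` has (SU-)rank `1`: the supremum of the SU-ranks of types in one variable over
sets of parameters in models of `T` is `1`. -/
def HasRankOne (T : L.Theory) : Prop :=
  (∃ (M : Theory.ModelType.{u, v, max u v} T) (A : Set M) (b : Fin 1 → M), SURankGE L 1 M A b) ∧
  ∀ (M : Theory.ModelType.{u, v, max u v} T) (A : Set M) (b : Fin 1 → M), ¬ SURankGE L 2 M A b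

/-- `φ(x̄, ȳ)` has the tree property in `M`: for some `r` there are parameters `a η`,
`η ∈ ω^{<ω}`, such that along each branch the instances are consistent (finitely satisfiable),
while the instances at the immediate successors of each node are `r`-inconsistent. -/
def HasTreeProperty (M : Type w) [L.Structure M] {m n : ℕ}
    (φ : L.Formula (Fin m ⊕ Fin n)) : Prop :=
  ∃ (r : ℕ) (a : List ℕ → Fin n → M),
    (∀ (σ : ℕ → ℕ) (S : Finset ℕ), ∃ b : Fin m → M,
      ∀ i ∈ S, φ.Realize (Sum.elim b (a (List.ofFn fun j : Fin i => σ j)))) ∧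
    ∀ (η : List ℕ) (S : Finset ℕ), S.card = r →
      ¬ ∃ b : Fin m → M, ∀ i ∈ S, φ.Realize (Sum.elim b (a (η ++ [i])))

/-- `T` is simple: no formula has the tree property in a model of `T`. -/
def IsSimpleTheory (T : L.Theory) : Prop :=
  ∀ (M : Theory.ModelType.{u, v, max u v} T) (m n : ℕ) (φ : L.Formula (Fin m ⊕ Fin n)),
    ¬ HasTreeProperty M φ

/-- The sequence `a` of `n`-tuples of `M`, indexed by a linear order, is indiscernible (over the
empty set). -/
def IsIndiscernible (L : FirstOrder.Language.{u, v}) {M : Type w} [L.Structure M] {I : Type*} [LinearOrder I]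
    {n : ℕ} (a : I → Fin n → M) : Prop :=
  ∀ (l : ℕ) (φ : L.Formula (Fin l × Fin n)) (i j : Fin l → I), StrictMono i → StrictMono j →
    (φ.Realize (fun p => a (i p.1) p.2) ↔ φ.Realize (fun p => a (j p.1) p.2))

end

end ModelNotions

/-! ### Templates and their theories -/

namespace HypergraphTemplate

/-- A `k`-full hypergraph: the edges on tuples of `k` distinct vertices form a symmetric
relation, and all tuples with fewer than `k` distinct entries are edges. -/
structure IsFull {k : ℕ} {V : Type*} (E : (Fin k → V) → Prop) : Prop where
  symm : ∀ v : Fin k → V, Function.Injective v → E v → ∀ σ : Equiv.Perm (Fin k), E (v ∘ σ)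
  of_not_injective : ∀ v : Fin k → V, ¬ Function.Injective v → E v

/-- A template of arity `k`: `k`-full hypergraphs `E n` on `{0, …, H n - 1}` and a function `f`.
In `extension`, the `(k-1)`-tuples are the `i ℓ`, with entries indexed by `1, …, k-1`; the tuple
`⟨s, i ℓ 1, …, i ℓ (k-1)⟩` is `w`. -/
structure Template (k : ℕ) where
  two_le : 2 ≤ k
  H : ℕ → ℕ
  E : ∀ n, (Fin k → Fin (H n)) → Prop
  f : ℕ → ℕ
  f_pos : ∀ n, 0 < f n
  f_tendsto : Filter.Tendsto f Filter.atTop Filter.atTop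
  full : ∀ n, IsFull (E n)
  f_le : ∀ n, f n ≤ H n
  extension : ∀ n (i : Fin (f n) → {j : Fin k // (j : ℕ) ≠ 0} → Fin (H n)),
    ∃ s : Fin (H n), ∀ ℓ : Fin (f n),
      E n (fun j => if h : (j : ℕ) ≠ 0 then i ℓ ⟨j, h⟩ else s)

variable {k : ℕ}

/-- The tree `X` of the template: finite sequences `η` with `η n < H n` for `n < lgn η`. -/
structure Node (𝓗 : Template k) where
  lgn : ℕ
  val : ∀ i : Fin lgn, Fin (𝓗.H i)

/-- The empty sequence. -/
def Node.root (𝓗 : Template k) : Node 𝓗 := ⟨0, fun i => i.elim0⟩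

/-- The sequence `η⌢⟨i⟩`. -/
def Node.append {𝓗 : Template k} (η : Node 𝓗) (i : Fin (𝓗.H η.lgn)) : Node 𝓗 :=
  ⟨η.lgn + 1, Fin.snoc (α := fun j : Fin (η.lgn + 1) => Fin (𝓗.H j)) η.val i⟩

/-- `η` is an initial segment of `ν`. -/
def Node.IsInitial {𝓗 : Template k} (η ν : Node 𝓗) : Prop :=
  ∃ h : η.lgn ≤ ν.lgn, ∀ i : Fin η.lgn, ν.val (Fin.castLE h i) = η.val i

/-- The relation symbols: a `k`-place `R` and unary predicates `Q η`. -/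
inductive Rel (𝓗 : Template k) : ℕ → Type
  | R : Rel 𝓗 k
  | Q (η : Node 𝓗) : Rel 𝓗 1

/-- The language of the template. -/
def lang (𝓗 : Template k) : FirstOrder.Language.{0, 0} := ⟨fun _ => Empty, Rel 𝓗⟩

/-- The symbol `R` in the language. -/
def symR (𝓗 : Template k) : (lang 𝓗).Relations k := Rel.R

/-- The symbol `Q_η` in the language. -/
def symQ {𝓗 : Template k} (η : Node 𝓗) : (lang 𝓗).Relations 1 := Rel.Q η

/-- The atomic formula `R(x_{t 0}, …, x_{t (k-1)})`. -/
def atomR (𝓗 : Template k) {n : ℕ} (t : Fin k → Fin n) : (lang 𝓗).BoundedFormula Empty n :=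
  (symR 𝓗).boundedFormula fun j => &(t j)

/-- The atomic formula `Q_η(x_j)`. -/
def atomQ {𝓗 : Template k} {n : ℕ} (η : Node 𝓗) (j : Fin n) :
    (lang 𝓗).BoundedFormula Empty n :=
  (symQ η).boundedFormula₁ (&j)

/-- The axioms of the universal theory `T₀` of the template. -/
inductive BaseAxiom (𝓗 : Template k) : (lang 𝓗).Sentence → Prop
  | irrefl (i j : Fin k) (h : i ≠ j) :
      BaseAxiom 𝓗 (atomR 𝓗 id ⟹ ∼((&i : (lang 𝓗).Term (Empty ⊕ Fin k)) =' &j)).alls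
  | symm (σ : Equiv.Perm (Fin k)) :
      BaseAxiom 𝓗 (atomR 𝓗 id ⟹ atomR 𝓗 σ).alls
  | root :
      BaseAxiom 𝓗 (atomQ (Node.root 𝓗) (0 : Fin 1)).alls
  | refine (η ν : Node 𝓗) (h : η.IsInitial ν) :
      BaseAxiom 𝓗 (atomQ ν (0 : Fin 1) ⟹ atomQ η (0 : Fin 1)).alls
  | disjoint (η : Node 𝓗) (i j : Fin (𝓗.H η.lgn)) (h : i ≠ j) :
      BaseAxiom 𝓗 (∼(atomQ (η.append i) (0 : Fin 1) ⊓ atomQ (η.append j) (0 : Fin 1))).alls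
  | cover (η : Node 𝓗) :
      BaseAxiom 𝓗 (atomQ η (0 : Fin 1) ⟹
        BoundedFormula.iSup fun i => atomQ (η.append i) (0 : Fin 1)).alls
  | edge (η : Fin k → Node 𝓗) (n : ℕ) (hn : ∀ j, n < (η j).lgn)
      (h : ¬ 𝓗.E n (fun j => (η j).val ⟨n, hn j⟩)) :
      BaseAxiom 𝓗 ((BoundedFormula.iInf fun j => atomQ (η j) j) ⟹ ∼(atomR 𝓗 id)).alls

/-- The universal theory `T₀` of the template. -/
def baseTheory (𝓗 : Template k) : (lang 𝓗).Theory := {φ | BaseAxiom 𝓗 φ}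

end HypergraphTemplate

/-! A model of `baseTheory` is a `k`-uniform hypergraph whose vertices carry branches of the tree,
every edge being allowed by `E n` at each level (`IsBase`). At a level with `m ^ (k-1) ≤ f n`, any
choice of `m` vertices has a common neighbour, so a new vertex over `m` given ones is constrained at
finitely many levels only. The model completion `modelTheory` says that every locally permitted
pattern of links below such a level is realized. Freely adjoining the required vertices (`Ext`)
embeds each model of the base theory in one of `modelTheory`. There, the truth of a formula depends
only on equalities, edges and the branches up to a finite level (`exists_level`). Every model of any
model completion satisfies `modelTheory`.

The rest follows from one amalgamation fact, `exists_sim_option`. If finitely many copies of a tuple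
meet only in positions where they agree, the links that a vertex has to the tuple can be requested
over all copies at once without conflict. Iterating, a solution of `φ(x, a)` that avoids the varying
entries of `a` yields a common solution over the copies (`exists_level_amalgam`). Hence only
equality divides. In a tree witnessing the tree property, one finds a branch whose solution has to
meet a fresh entry at each node, which is impossible beyond `m` nodes. An element outside the base
does not fork and one already in the parameters cannot fork again, so the rank is at most `1`; the
formula `x = b` shows that it is attained. -/

namespace HypergraphTemplate

variable {k : ℕ} {𝓗 : Template k} {M N : Type}

/-! ### Branches and links -/

/-- Positions of the entries of a `k`-tuple other than the initial one. -/
abbrev Link (k : ℕ) := {j : Fin k // (j : ℕ) ≠ 0}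

/-- The `k`-tuple with initial entry `d` and remaining entries `w`. -/
def cons {V : Type*} (d : V) (w : Link k → V) : Fin k → V :=
  fun j => if h : (j : ℕ) ≠ 0 then w ⟨j, h⟩ else d

theorem comp_cons {V V' : Type*} (g : V → V') (d : V) (w : Link k → V) :
    g ∘ cons d w = cons (g d) (g ∘ w) := by
  funext j
  simp only [Function.comp, cons]
  split_ifs <;> rfl

/-- The infinite branches of the tree `X`. -/
abbrev Branch (𝓗 : Template k) := ∀ n, Fin (𝓗.H n)

theorem Template.H_pos (𝓗 : Template k) (n : ℕ) : 0 < 𝓗.H n :=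
  (𝓗.f_pos n).trans_le (𝓗.f_le n)

instance (𝓗 : Template k) (n : ℕ) : Nonempty (Fin (𝓗.H n)) := ⟨⟨0, 𝓗.H_pos n⟩⟩

instance (𝓗 : Template k) : Nonempty (Branch 𝓗) := ⟨fun n => ⟨0, 𝓗.H_pos n⟩⟩

/-- The restriction of a branch to a node of length `L`. -/
def cut (s : Branch 𝓗) (L : ℕ) : Node 𝓗 := ⟨L, fun i => s i⟩

theorem exists_cut_eq (η : Node 𝓗) : ∃ s : Branch 𝓗, cut s η.lgn = η := by
  classical
  refine ⟨fun n => if h : n < η.lgn then η.val ⟨n, h⟩ else Classical.arbitrary _, ?_⟩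
  rcases η with ⟨L, v⟩
  unfold cut
  congr 1
  funext i
  simp

theorem append_cut {s t : Branch 𝓗} {L : ℕ} (h : ∀ n < L, s n = t n) :
    (cut s L).append (t L) = cut t (L + 1) := by
  unfold cut Node.append
  congr 1
  funext i
  refine Fin.lastCases ?_ (fun i => ?_) i
  · simp
  · simpa using h i i.2

theorem cut_isInitial (s : Branch 𝓗) {L L' : ℕ} (h : L ≤ L') :
    (cut s L).IsInitial (cut s L') :=
  ⟨h, fun _ => rfl⟩

theorem Template.symm (𝓗 : Template k) {n : ℕ} {v : Fin k → Fin (𝓗.H n)} (h : 𝓗.E n v)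
    (σ : Equiv.Perm (Fin k)) : 𝓗.E n (v ∘ σ) := by
  by_cases hv : Function.Injective v
  · exact (𝓗.full n).symm v hv h σ
  · refine (𝓗.full n).of_not_injective _ fun hi => hv ?_
    simpa [Function.comp_assoc] using hi.comp σ.symm.injective

/-! ### The relations of a structure -/

section

variable (𝓗)
variable [(lang 𝓗).Structure M] [(lang 𝓗).Structure N]

/-- The edge relation. -/
def Edge (v : Fin k → M) : Prop := Structure.RelMap (symR 𝓗) v

/-- The interpretation of `Q_η`. -/
def Pred {𝓗 : Template k} [(lang 𝓗).Structure M] (η : Node 𝓗) (x : M) : Prop :=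
  Structure.RelMap (symQ η) ![x]

open Classical in
/-- The branch of an element. -/
noncomputable def br (x : M) : Branch 𝓗 :=
  if h : ∃ s : Branch 𝓗, ∀ η : Node 𝓗, Pred η x ↔ ∀ i : Fin η.lgn, s i = η.val i then h.choose
  else Classical.arbitrary _

variable {𝓗}

theorem br_eq {x : M} {s : Branch 𝓗} (hs : ∀ η : Node 𝓗, Pred η x ↔ ∀ i : Fin η.lgn, s i = η.val i) :
    br 𝓗 x = s := by
  have h : ∃ s : Branch 𝓗, ∀ η : Node 𝓗, Pred η x ↔ ∀ i : Fin η.lgn, s i = η.val i := ⟨s, hs⟩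
  have h2 := h.choose_spec
  rw [br, dif_pos h]
  funext n
  have h3 := (h2 (cut s (n + 1))).1 ((hs _).2 fun i => rfl)
  exact h3 (Fin.last n)

variable (𝓗 M) in
/-- The semantic content of the base theory. -/
structure IsBase : Prop where
  inj : ∀ {v : Fin k → M}, Edge 𝓗 v → Function.Injective v
  symm : ∀ {v : Fin k → M}, Edge 𝓗 v → ∀ σ : Equiv.Perm (Fin k), Edge 𝓗 (v ∘ σ)
  edge : ∀ {v : Fin k → M}, Edge 𝓗 v → ∀ n, 𝓗.E n (fun j => br 𝓗 (v j) n)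
  pred : ∀ {η : Node 𝓗} {x : M}, Pred η x ↔ ∀ i : Fin η.lgn, br 𝓗 x i = η.val i

theorem realize_atomR {n : ℕ} {t : Fin k → Fin n} {v : Empty → M} {xs : Fin n → M} :
    (atomR 𝓗 t).Realize v xs ↔ Edge 𝓗 (xs ∘ t) := by
  simp only [atomR, BoundedFormula.realize_rel]
  rfl

theorem realize_atomQ {n : ℕ} {η : Node 𝓗} {j : Fin n} {v : Empty → M} {xs : Fin n → M} :
    (atomQ η j).Realize v xs ↔ Pred η (xs j) := by
  simp only [atomQ, BoundedFormula.realize_rel₁]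
  rfl

theorem realize_sentence_alls {n : ℕ} {φ : (lang 𝓗).BoundedFormula Empty n} :
    Sentence.Realize M φ.alls ↔ ∀ xs : Fin n → M, φ.Realize default xs := by
  rw [Sentence.Realize, BoundedFormula.realize_alls]

theorem IsBase.pred_cut (h : IsBase 𝓗 M) {s : Branch 𝓗} {L : ℕ} {x : M} :
    Pred (cut s L) x ↔ ∀ n < L, br 𝓗 x n = s n := by
  rw [h.pred]
  exact ⟨fun h n hn => h ⟨n, hn⟩, fun h i => h i i.2⟩

theorem IsBase.model (h : IsBase 𝓗 M) : M ⊨ baseTheory 𝓗 := by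
  refine (Theory.model_iff _).2 fun φ hφ => ?_
  induction (hφ : BaseAxiom 𝓗 φ) with
  | irrefl i j hij =>
    rw [realize_sentence_alls]
    intro xs
    simp only [BoundedFormula.realize_imp, realize_atomR, BoundedFormula.realize_not,
      BoundedFormula.realize_bdEqual]
    exact fun he hx => hij (h.inj he hx)
  | symm σ =>
    rw [realize_sentence_alls]
    intro xs
    simp only [BoundedFormula.realize_imp, realize_atomR]
    exact fun he => h.symm he σ
  | root =>
    rw [realize_sentence_alls]
    intro xs
    rw [realize_atomQ, h.pred]
    exact fun i => i.elim0
  | refine η ν hην =>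
    rw [realize_sentence_alls]
    intro xs
    simp only [BoundedFormula.realize_imp, realize_atomQ, h.pred]
    intro hi i
    obtain ⟨hle, hv⟩ := hην
    rw [← hv i]
    exact hi (Fin.castLE hle i)
  | disjoint η i j hij =>
    rw [realize_sentence_alls]
    intro xs
    simp only [BoundedFormula.realize_not, BoundedFormula.realize_inf, realize_atomQ, h.pred]
    rintro ⟨h1, h2⟩
    have h1 := h1 (Fin.last _)
    have h2 := h2 (Fin.last _)
    simp only [Node.append, Fin.snoc_last] at h1 h2
    exact hij (h1.symm.trans h2)
  | cover η =>
    rw [realize_sentence_alls]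
    intro xs
    simp only [BoundedFormula.realize_imp, BoundedFormula.realize_iSup, realize_atomQ, h.pred]
    intro hi
    refine ⟨br 𝓗 (xs 0) η.lgn, fun i => ?_⟩
    refine Fin.lastCases ?_ (fun i => ?_) i
    · simp [Node.append]
    · simpa [Node.append] using hi i
  | edge η n hn hE =>
    rw [realize_sentence_alls]
    intro xs
    simp only [BoundedFormula.realize_imp, BoundedFormula.realize_iInf, realize_atomQ, h.pred,
      BoundedFormula.realize_not, realize_atomR]
    intro hi he
    apply hE
    have := h.edge he n
    convert this using 1
    funext j
    exact (hi j ⟨n, hn j⟩).symm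

theorem isBase_of_branches (s : M → Branch 𝓗)
    (pred : ∀ (η : Node 𝓗) (x : M), Pred η x ↔ ∀ i : Fin η.lgn, s x i = η.val i)
    (inj : ∀ v : Fin k → M, Edge 𝓗 v → Function.Injective v)
    (symm : ∀ v : Fin k → M, Edge 𝓗 v → ∀ σ : Equiv.Perm (Fin k), Edge 𝓗 (v ∘ σ))
    (edge : ∀ v : Fin k → M, Edge 𝓗 v → ∀ n, 𝓗.E n (fun j => s (v j) n)) : IsBase 𝓗 M := by
  have hb : ∀ x : M, br 𝓗 x = s x := fun x => br_eq fun η => pred η x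
  refine ⟨fun h => inj _ h, fun h => symm _ h, fun {v} h n => ?_, fun {η x} => ?_⟩
  · simpa only [hb] using edge v h n
  · rw [hb, pred]

/-- The covering axioms give each element a node of every length, disjointness makes these nodes
compatible, and together they form its branch. -/
theorem isBase_of_model (hM : M ⊨ baseTheory 𝓗) : IsBase 𝓗 M := by
  have ax : ∀ {n : ℕ} {φ : (lang 𝓗).BoundedFormula Empty n}, BaseAxiom 𝓗 φ.alls →
      ∀ xs : Fin n → M, φ.Realize default xs := fun h =>
    realize_sentence_alls.1 ((Theory.model_iff _).1 hM _ h)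
  have refine' : ∀ {η ν : Node 𝓗} {x : M}, η.IsInitial ν → Pred ν x → Pred η x := by
    intro η ν x h hx
    have := ax (.refine η ν h) (fun _ => x)
    simp only [BoundedFormula.realize_imp, realize_atomQ] at this
    exact this hx
  have ex : ∀ (x : M) (L : ℕ), ∃ s : Branch 𝓗, Pred (cut s L) x := by
    intro x L
    induction L with
    | zero =>
      refine ⟨Classical.arbitrary _, ?_⟩
      have := ax .root (fun _ => x)
      rw [realize_atomQ] at this
      convert this using 1
      unfold cut Node.root
      congr 1
      funext i
      exact i.elim0
    | succ L ih =>
      obtain ⟨s, hs⟩ := ih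
      have := ax (.cover (cut s L)) (fun _ => x)
      simp only [BoundedFormula.realize_imp, BoundedFormula.realize_iSup, realize_atomQ] at this
      obtain ⟨i, hi⟩ := this hs
      refine ⟨Function.update s L i, ?_⟩
      have h2 := append_cut (s := s) (t := Function.update s L i) (L := L)
        fun n hn => (Function.update_of_ne hn.ne _ _).symm
      have h3 : Function.update s L i L = i := Function.update_self ..
      rw [← h2]
      exact h3.symm ▸ hi
  have uniq : ∀ (x : M) (L : ℕ) (s t : Branch 𝓗), Pred (cut s L) x → Pred (cut t L) x →
      ∀ n < L, s n = t n := by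
    intro x L s t
    induction L with
    | zero => intro _ _ n hn; omega
    | succ L ih =>
      intro h1 h2 n hn
      have h3 := ih (refine' (cut_isInitial s (Nat.le_succ L)) h1)
        (refine' (cut_isInitial t (Nat.le_succ L)) h2)
      rcases Nat.lt_succ_iff_lt_or_eq.1 hn with hn | rfl
      · exact h3 n hn
      · by_contra hne
        have := ax (.disjoint (cut s n) (s n) (t n) hne) (fun _ => x)
        simp only [BoundedFormula.realize_not, BoundedFormula.realize_inf, realize_atomQ] at this
        refine this ⟨?_, ?_⟩
        · rwa [append_cut fun _ _ => rfl]
        · rwa [append_cut h3]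
  choose S hS using ex
  have key : ∀ (η : Node 𝓗) (x : M), Pred η x ↔ ∀ i : Fin η.lgn, S x (i + 1) i = η.val i := by
    intro η x
    have hagree : ∀ L, ∀ n < L, S x (n + 1) n = S x L n := fun L n hn =>
      uniq x (n + 1) _ _ (hS x _) (refine' (cut_isInitial _ hn) (hS x L)) n (Nat.lt_succ_self n)
    obtain ⟨s, hs⟩ := exists_cut_eq η
    constructor
    · intro h i
      rw [hagree η.lgn i i.2]
      rw [← hs] at h
      rw [uniq x _ _ _ (hS x _) h i i.2]
      exact congrFun (eq_of_heq (by rw [hs] : HEq (cut s η.lgn).val η.val)) i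
    · intro h
      have : cut (S x η.lgn) η.lgn = η := by
        rcases η with ⟨L, v⟩
        unfold cut
        congr 1
        funext i
        exact (hagree L i i.2).symm.trans (h i)
      rw [← this]
      exact hS x _
  refine isBase_of_branches (fun x n => S x (n + 1) n) key ?_ ?_ ?_
  · intro v hv i j hij
    by_contra hne
    have := ax (.irrefl i j hne) v
    simp only [BoundedFormula.realize_imp, realize_atomR, BoundedFormula.realize_not,
      BoundedFormula.realize_bdEqual] at this
    exact this hv hij
  · intro v hv σ
    have := ax (.symm σ) v
    simp only [BoundedFormula.realize_imp, realize_atomR] at this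
    exact this hv
  · intro v hv n
    by_contra hE
    have := ax (.edge (fun j => cut (fun n => S (v j) (n + 1) n) (n + 1)) n
      (fun _ => Nat.lt_succ_self n) hE) v
    simp only [BoundedFormula.realize_imp, BoundedFormula.realize_iInf, realize_atomQ,
      BoundedFormula.realize_not, realize_atomR] at this
    exact this (fun j => (key _ _).2 fun i => rfl) hv

theorem map_edge (g : M ↪[lang 𝓗] N) {v : Fin k → M} : Edge 𝓗 (g ∘ v) ↔ Edge 𝓗 v :=
  g.map_rel _ _

theorem map_pred (g : M ↪[lang 𝓗] N) {η : Node 𝓗} {x : M} : Pred η (g x) ↔ Pred η x := by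
  unfold Pred
  rw [← g.map_rel]
  congr! 1
  funext i
  simp

theorem map_br (hM : IsBase 𝓗 M) (g : M ↪[lang 𝓗] N) (x : M) : br 𝓗 (g x) = br 𝓗 x :=
  br_eq fun η => by rw [map_pred, hM.pred]

theorem relMap_symQ {η : Node 𝓗} (y : Fin 1 → M) :
    Structure.RelMap (symQ η) y ↔ Pred η (y 0) := by
  unfold Pred
  congr! 1
  funext i
  rw [Subsingleton.elim i 0]
  rfl

/-- An embedding, from its semantic description. -/
def mkEmbedding (hM : IsBase 𝓗 M) (hN : IsBase 𝓗 N) (g : M ↪ N)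
    (hb : ∀ x, br 𝓗 (g x) = br 𝓗 x) (he : ∀ v : Fin k → M, Edge 𝓗 (g ∘ v) ↔ Edge 𝓗 v) :
    M ↪[lang 𝓗] N where
  toEmbedding := g
  map_fun' f := nomatch f
  map_rel' := by
    intro n r x
    cases r with
    | R => exact he x
    | Q η =>
      refine (relMap_symQ _).trans (Iff.trans ?_ (relMap_symQ _).symm)
      rw [hM.pred, hN.pred]
      simp [hb]

end

/-! ### The extension axioms -/

/-- From level `L` on, all links on `m` vertices have a common extension. -/
def Template.Large (𝓗 : Template k) (L m : ℕ) : Prop :=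
  ∀ n, L ≤ n → m ^ Fintype.card (Link k) ≤ 𝓗.f n

theorem Template.Large.mono {L L' m m' : ℕ} (h : 𝓗.Large L m) (hL : L ≤ L') (hm : m' ≤ m) :
    𝓗.Large L' m' :=
  fun n hn => (Nat.pow_le_pow_left hm _).trans (h n (hL.trans hn))

theorem Template.exists_large (𝓗 : Template k) (m : ℕ) : ∃ L, 𝓗.Large L m :=
  Filter.eventually_atTop.1 (𝓗.f_tendsto.eventually_ge_atTop (m ^ Fintype.card (Link k)))

/-- All links within the `m` vertices fit into one list of `f n` tuples, to which the template
condition applies; surplus places of the list get arbitrary values. -/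
theorem Template.exists_common_vertex (𝓗 : Template k) {n : ℕ} {ι : Type} [Fintype ι]
    (hι : Fintype.card ι ^ Fintype.card (Link k) ≤ 𝓗.f n) (c : ι → Fin (𝓗.H n)) :
    ∃ s : Fin (𝓗.H n), ∀ t : Link k → ι, 𝓗.E n (cons s (c ∘ t)) := by
  classical
  rw [← Fintype.card_fun] at hι
  obtain ⟨e⟩ : Nonempty ((Link k → ι) ↪ Fin (𝓗.f n)) :=
    Function.Embedding.nonempty_of_card_le (by simpa using hι)
  obtain ⟨s, hs⟩ := 𝓗.extension n
    (Function.extend e (fun t => c ∘ t) (fun _ _ => Classical.arbitrary _))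
  refine ⟨s, fun t => ?_⟩
  have := hs (e t)
  rw [e.injective.extend_apply] at this
  exact this

open Classical in
/-- There is a new vertex on the node `cut s L` whose links within `x_0, …, x_{m-1}` are those
with range in `W`. -/
noncomputable def extFormula (m L : ℕ) (s : Branch 𝓗) (W : Set (Set (Fin m))) :
    (lang 𝓗).BoundedFormula Empty m :=
  ∃' ((BoundedFormula.iInf fun i : Fin m =>
      ∼((&(Fin.castSucc i) : (lang 𝓗).Term (Empty ⊕ Fin (m + 1))) =' &(Fin.last m))) ⊓
    (atomQ (cut s L) (Fin.last m) ⊓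
      BoundedFormula.iInf fun t : {t : Link k → Fin m // Function.Injective t} =>
        if Set.range t.1 ∈ W then atomR 𝓗 (cons (Fin.last m) (Fin.castSucc ∘ t.1))
        else ∼(atomR 𝓗 (cons (Fin.last m) (Fin.castSucc ∘ t.1)))))

/-- `extFormula` holds of all tuples of distinct elements on the nodes `cut (ν i) L`. -/
noncomputable def extAxiom (m L : ℕ) (s : Branch 𝓗) (ν : Fin m → Branch 𝓗)
    (W : Set (Set (Fin m))) : (lang 𝓗).Sentence :=
  (((BoundedFormula.iInf fun p : {p : Fin m × Fin m // p.1 ≠ p.2} =>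
      ∼((&p.1.1 : (lang 𝓗).Term (Empty ⊕ Fin m)) =' &p.1.2)) ⊓
    BoundedFormula.iInf fun i : Fin m => atomQ (cut (ν i) L) i) ⟹ extFormula m L s W).alls

/-- The extension axioms that are consistent with the base theory. -/
inductive ExtAxiom (𝓗 : Template k) : (lang 𝓗).Sentence → Prop
  | mk (m L : ℕ) (s : Branch 𝓗) (ν : Fin m → Branch 𝓗) (W : Set (Set (Fin m)))
      -- From level `L` on the template supplies the entries of the new branch, so compatibility
      -- matters only below `L`.
      (large : 𝓗.Large L m)
      (compat : ∀ t : Link k → Fin m, Function.Injective t → Set.range t ∈ W →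
        ∀ n < L, 𝓗.E n (cons (s n) fun j => ν (t j) n)) : ExtAxiom 𝓗 (extAxiom m L s ν W)

/-- The model completion of the base theory. -/
def modelTheory (𝓗 : Template k) : (lang 𝓗).Theory := baseTheory 𝓗 ∪ {φ | ExtAxiom 𝓗 φ}

section

variable [(lang 𝓗).Structure M] [(lang 𝓗).Structure N]

theorem realize_extFormula {m L : ℕ} {s : Branch 𝓗} {W : Set (Set (Fin m))} {v : Empty → M}
    {a : Fin m → M} : (extFormula m L s W).Realize v a ↔
      ∃ x, (∀ i, a i ≠ x) ∧ Pred (cut s L) x ∧ ∀ t : Link k → Fin m, Function.Injective t →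
        (Edge 𝓗 (cons x (a ∘ t)) ↔ Set.range t ∈ W) := by
  classical
  unfold extFormula
  simp only [BoundedFormula.realize_ex, BoundedFormula.realize_inf, BoundedFormula.realize_iInf,
    BoundedFormula.realize_not, BoundedFormula.realize_bdEqual, Function.comp_apply, Term.realize_var,
    Sum.elim_inr, realize_atomQ, Fin.snoc_last, Fin.snoc_castSucc, Subtype.forall]
  refine exists_congr fun x => and_congr_right fun _ => and_congr_right fun _ =>
    forall_congr' fun t => forall_congr' fun _ => ?_
  have h : (Fin.snoc a x : Fin (m + 1) → M) ∘ cons (Fin.last m) (Fin.castSucc ∘ t) =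
      cons x (a ∘ t) := by
    rw [comp_cons]
    congr 1
    · simp
    · funext j
      simp
  split_ifs with hW
  · simp [realize_atomR, h, hW]
  · simp [realize_atomR, h, hW]

theorem realize_extAxiom {m L : ℕ} {s : Branch 𝓗} {ν : Fin m → Branch 𝓗}
    {W : Set (Set (Fin m))} : Sentence.Realize M (extAxiom m L s ν W) ↔
      ∀ a : Fin m → M, Function.Injective a → (∀ i, Pred (cut (ν i) L) (a i)) →
        (extFormula m L s W).Realize default a := by
  rw [extAxiom, realize_sentence_alls]
  simp only [BoundedFormula.realize_imp, BoundedFormula.realize_inf, BoundedFormula.realize_iInf,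
    BoundedFormula.realize_not, BoundedFormula.realize_bdEqual, Function.comp_apply, Term.realize_var,
    Sum.elim_inr, realize_atomQ, Subtype.forall, Prod.forall]
  refine forall_congr' fun a => ⟨fun h h1 h2 => h ⟨fun i j hij h3 => hij (h1 h3), h2⟩,
    fun h h1 => h (fun i j hij => ?_) h1.2⟩
  by_contra hne
  exact h1.1 i j hne hij

theorem isBase_of_modelTheory (hM : M ⊨ modelTheory 𝓗) : IsBase 𝓗 M :=
  isBase_of_model (hM.mono Set.subset_union_left)

/-- Existence of new vertices with prescribed node and prescribed links in a finite set. -/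
theorem exists_vertex (hM : M ⊨ modelTheory 𝓗) (B : Finset M) (W : Set (Set M)) (L : ℕ)
    (s : Branch 𝓗) (hL : 𝓗.Large L B.card)
    (hc : ∀ w : Link k → M, Function.Injective w → (∀ j, w j ∈ B) → Set.range w ∈ W →
      ∀ n < L, 𝓗.E n (cons (s n) fun j => br 𝓗 (w j) n)) :
    ∃ x ∉ B, (∀ n < L, br 𝓗 x n = s n) ∧ ∀ w : Link k → M, Function.Injective w →
      (∀ j, w j ∈ B) → (Edge 𝓗 (cons x w) ↔ Set.range w ∈ W) := by
  have hb := isBase_of_modelTheory hM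
  let e : Fin B.card ≃ B := B.equivFin.symm
  let a : Fin B.card → M := fun i => e i
  have ha : Function.Injective a := Subtype.val_injective.comp e.injective
  have hrange : ∀ x ∈ B, ∃ i, a i = x := fun x hx => ⟨e.symm ⟨x, hx⟩, by simp [a]⟩
  have hax := (Theory.model_iff _).1 hM _ (Or.inr (ExtAxiom.mk B.card L s
    (fun i => br 𝓗 (a i)) {t | a '' t ∈ W} hL fun t ht hW n hn =>
      hc (a ∘ t) (ha.comp ht) (fun j => (e (t j)).2) (by rw [Set.range_comp]; exact hW) n hn))
  obtain ⟨x, hx, hs, hW⟩ := realize_extFormula.1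
    (realize_extAxiom.1 hax a ha fun i => hb.pred_cut.2 fun _ _ => rfl)
  refine ⟨x, fun hxB => ?_, hb.pred_cut.1 hs, fun w hw hwB => ?_⟩
  · obtain ⟨i, hi⟩ := hrange x hxB
    exact hx i hi
  · choose t ht using fun j => hrange (w j) (hwB j)
    obtain rfl : a ∘ t = w := funext ht
    rw [hW t (Function.Injective.of_comp hw), Set.range_comp]
    rfl

end

/-! ### Existentially closed extensions -/

/-- The elements of `M` together with, freely, new vertices with prescribed branch `s` and
prescribed links in a finite tuple `a` of elements. -/
inductive Ext (𝓗 : Template k) (M : Type) : Type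
  | base : M → Ext 𝓗 M
  | new (s : Branch 𝓗) (m : ℕ) (a : Fin m → Ext 𝓗 M) (S : Set (Set (Fin m))) : Ext 𝓗 M

namespace Ext

/-- The stage at which an element is added. -/
def rank : Ext 𝓗 M → ℕ
  | base _ => 0
  | new _ _ a _ => (∑ i, rank (a i)) + 1

/-- A vertex never occurs among the parameters of its own parameters; so edges requested by older
vertices cannot involve it. -/
theorem rank_lt (s : Branch 𝓗) {m : ℕ} (a : Fin m → Ext 𝓗 M) (S : Set (Set (Fin m)))
    (i : Fin m) : (a i).rank < (new s m a S).rank := by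
  have := Finset.single_le_sum (f := fun i => (a i).rank) (fun _ _ => Nat.zero_le _)
    (Finset.mem_univ i)
  simp only [rank]
  omega

section

variable [(lang 𝓗).Structure M]

/-- The branch of an element of the extension. -/
noncomputable def branch : Ext 𝓗 M → Branch 𝓗
  | base x => br 𝓗 x
  | new s _ _ _ => s

/-- The edges of the extension. -/
def IsEdge (v : Fin k → Ext 𝓗 M) : Prop :=
  Function.Injective v ∧ (∀ n, 𝓗.E n fun j => (v j).branch n) ∧
    -- An edge is old, or one of its vertices requested the set of all the others. Leaving the
    -- position `j` free makes the relation symmetric.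
    ((∃ u : Fin k → M, v = base ∘ u ∧ Edge 𝓗 u) ∨
      ∃ (j : Fin k) (s : Branch 𝓗) (m : ℕ) (a : Fin m → Ext 𝓗 M) (S : Set (Set (Fin m))),
        v j = new s m a S ∧ ∃ t ∈ S, a '' t = v '' {i | i ≠ j})

noncomputable instance : (lang 𝓗).Structure (Ext 𝓗 M) where
  funMap f := nomatch f
  RelMap {n} r x := match n, r, x with
    | _, Rel.R, v => IsEdge v
    | _, Rel.Q η, x => ∀ i : Fin η.lgn, (x 0).branch i = η.val i

theorem edge_iff {v : Fin k → Ext 𝓗 M} : Edge 𝓗 v ↔ IsEdge v := Iff.rfl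

theorem pred_iff {η : Node 𝓗} {x : Ext 𝓗 M} :
    Pred η x ↔ ∀ i : Fin η.lgn, x.branch i = η.val i := Iff.rfl

theorem br_eq_branch (x : Ext 𝓗 M) : br 𝓗 x = x.branch := br_eq fun _ => pred_iff

theorem isBase (hM : IsBase 𝓗 M) : IsBase 𝓗 (Ext 𝓗 M) := by
  refine isBase_of_branches branch (fun _ _ => pred_iff) (fun v hv => hv.1) ?_
    fun v hv => hv.2.1
  rintro v ⟨h1, h2, h3⟩ σ
  refine ⟨h1.comp σ.injective, fun n => 𝓗.symm (h2 n) σ, ?_⟩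
  rcases h3 with ⟨u, rfl, hu⟩ | ⟨j, s, m, a, S, hj, t, ht, hat⟩
  · exact Or.inl ⟨u ∘ σ, rfl, hM.symm hu σ⟩
  · refine Or.inr ⟨σ.symm j, s, m, a, S, by simpa using hj, t, ht, ?_⟩
    rw [hat, Set.image_comp]
    congr 1
    ext i
    simp only [Set.mem_ofPred_eq, Set.mem_image, ne_eq]
    constructor
    · exact fun hi => ⟨σ.symm i, by simpa using hi, by simp⟩
    · rintro ⟨i, hi, rfl⟩ h
      exact hi (by simp [← h])

/-- The inclusion of `M` in its extension. -/
noncomputable def inclusion (hM : IsBase 𝓗 M) : M ↪[lang 𝓗] Ext 𝓗 M :=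
  mkEmbedding hM (isBase hM) ⟨base, fun _ _ h => by injection h⟩
    (fun x => by rw [br_eq_branch]; rfl) fun u => by
      rw [edge_iff]
      constructor
      · rintro ⟨_, _, ⟨u', h, hu'⟩ | ⟨j, s, m, a, S, hj, _⟩⟩
        · obtain rfl : u = u' := funext fun i => by
            have := congrFun h i
            injection this
          exact hu'
        · simp at hj
      · intro hu
        refine ⟨fun i j h => hM.inj hu (by simpa using h), hM.edge hu, Or.inl ⟨u, rfl, hu⟩⟩

theorem cons_image_ne {V : Type*} (d : V) (w : Link k → V) {j : Fin k} (hj : (j : ℕ) = 0) :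
    cons d w '' {i | i ≠ j} = Set.range w := by
  ext y
  simp only [Set.mem_image, Set.mem_ofPred_eq, Set.mem_range]
  constructor
  · rintro ⟨i, hi, rfl⟩
    have : (i : ℕ) ≠ 0 := fun h => hi (Fin.ext (h.trans hj.symm))
    exact ⟨⟨i, this⟩, by simp [cons, this]⟩
  · rintro ⟨⟨i, hi⟩, rfl⟩
    exact ⟨i, fun h => hi (h ▸ hj), by simp [cons, hi]⟩

theorem injective_cons {V : Type*} {d : V} {w : Link k → V} (hw : Function.Injective w)
    (hd : ∀ j, w j ≠ d) : Function.Injective (cons d w) := by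
  intro i j hij
  by_cases hi : (i : ℕ) = 0 <;> by_cases hj : (j : ℕ) = 0
  · exact Fin.ext (hi.trans hj.symm)
  · simp only [cons, hi, hj, ne_eq, not_true, not_false_iff, dite_true, dite_false] at hij
    exact absurd hij.symm (hd _)
  · simp only [cons, hi, hj, ne_eq, not_true, not_false_iff, dite_true, dite_false] at hij
    exact absurd hij (hd _)
  · simp only [cons, hi, hj, ne_eq, not_false_iff, dite_true] at hij
    exact congrArg Subtype.val (hw hij)

/-- The formal vertex `new s' m a W` is the witness, where `s'` follows `s` below `L` and is a
common neighbour of the entries of `a` at each later level. -/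
theorem model (hM : IsBase 𝓗 M) : Ext 𝓗 M ⊨ modelTheory 𝓗 := by
  have hb := isBase hM
  refine (Theory.model_iff _).2 ?_
  rintro φ (hφ | hφ)
  · exact (Theory.model_iff _).1 hb.model φ hφ
  induction (hφ : ExtAxiom 𝓗 φ) with
  | mk m L s ν W large compat =>
  rw [realize_extAxiom]
  intro a ha hν
  rw [realize_extFormula]
  have hbr : ∀ i, ∀ n < L, (a i).branch n = ν i n := fun i n hn => by
    rw [← br_eq_branch]
    exact hb.pred_cut.1 (hν i) n hn
  have hs : ∀ n, ∃ y : Fin (𝓗.H n), (n < L → y = s n) ∧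
      (L ≤ n → ∀ t : Link k → Fin m, 𝓗.E n (cons y fun j => (a (t j)).branch n)) := by
    intro n
    by_cases hn : n < L
    · exact ⟨s n, fun _ => rfl, fun h => absurd hn (not_lt.2 h)⟩
    · push Not at hn
      obtain ⟨y, hy⟩ := 𝓗.exists_common_vertex (ι := Fin m) (by simpa using large n hn)
        fun i => (a i).branch n
      exact ⟨y, fun h => absurd hn (not_le.2 h), fun _ => hy⟩
  choose s' hs1 hs2 using hs
  set x : Ext 𝓗 M := new s' m a W with hx
  have hax : ∀ i, a i ≠ x := fun i h => (rank_lt s' a W i).ne (congrArg rank h)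
  refine ⟨x, hax, hb.pred_cut.2 fun n hn => by rw [br_eq_branch]; exact hs1 n hn,
    fun t ht => ?_⟩
  have hk : 0 < k := two_pos.trans_le 𝓗.two_le
  constructor
  · rintro ⟨-, -, ⟨u, hu, -⟩ | ⟨j, r, m', a', S, hj, t', ht', himage⟩⟩
    · have := congrFun hu ⟨0, hk⟩
      simp [cons, hx] at this
    · by_cases hj0 : (j : ℕ) = 0
      · rw [cons_image_ne _ _ hj0] at himage
        simp only [cons, hj0, ne_eq, not_true, dite_false, hx] at hj
        injection hj with h1 h2 h3 h4
        subst h2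
        obtain rfl := eq_of_heq h3
        obtain rfl := eq_of_heq h4
        rw [Set.range_comp] at himage
        rwa [← ha.image_injective himage]
      -- Here an entry of `a` would have requested the edge, so `x` would be one of its parameters,
      -- against the rank.
      · simp only [cons, hj0, ne_eq, not_false_iff, dite_true, Function.comp] at hj
        have h1 : x ∈ a' '' t' := by
          rw [himage]
          exact ⟨⟨0, hk⟩, fun h => hj0 (by rw [← h]), by simp [cons]⟩
        obtain ⟨i, -, hi⟩ := h1
        have h2 := rank_lt r a' S i
        rw [hi, ← hj] at h2
        exact absurd (rank_lt s' a W (t ⟨j, hj0⟩)) h2.asymm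
  · intro hW
    refine ⟨injective_cons (ha.comp ht) fun j => hax _, fun n => ?_, Or.inr
      ⟨⟨0, hk⟩, s', m, a, W, by simp [cons, hx], Set.range t, hW, ?_⟩⟩
    · have h1 : (fun j => (cons x (a ∘ t) j).branch n) =
          cons (s' n) fun j => (a (t j)).branch n := comp_cons (fun y => branch y n) _ _
      rw [h1]
      by_cases hn : n < L
      · rw [hs1 n hn]
        simp only [hbr _ n hn]
        exact compat t ht hW n hn
      · exact hs2 n (not_lt.1 hn) t
    · rw [cons_image_ne _ _ rfl, Set.range_comp]

end

end Ext

/-! ### Finite approximations of quantifier-free types -/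

section

variable [(lang 𝓗).Structure M] [(lang 𝓗).Structure N] {ι ι' I : Type}

variable (𝓗) in
/-- The tuples `a`, `c` satisfy the same equalities and edges, and their entries have the same
branches below level `L`. -/
structure Sim (L : ℕ) (a : ι → M) (c : ι → N) : Prop where
  eq_iff : ∀ i j, a i = a j ↔ c i = c j
  br_eq : ∀ i, ∀ n < L, br 𝓗 (a i) n = br 𝓗 (c i) n
  edge_iff : ∀ v : Fin k → ι, Edge 𝓗 (a ∘ v) ↔ Edge 𝓗 (c ∘ v)

namespace Sim

variable {L L' : ℕ} {a : ι → M} {c : ι → N}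

theorem symm (h : Sim 𝓗 L a c) : Sim 𝓗 L c a :=
  ⟨fun i j => (h.eq_iff i j).symm, fun i n hn => (h.br_eq i n hn).symm,
    fun v => (h.edge_iff v).symm⟩

theorem trans {P : Type} [(lang 𝓗).Structure P] {e : ι → P} (h : Sim 𝓗 L a c)
    (h' : Sim 𝓗 L c e) : Sim 𝓗 L a e :=
  ⟨fun i j => (h.eq_iff i j).trans (h'.eq_iff i j),
    fun i n hn => (h.br_eq i n hn).trans (h'.br_eq i n hn),
    fun v => (h.edge_iff v).trans (h'.edge_iff v)⟩

theorem mono (h : Sim 𝓗 L a c) (hL : L' ≤ L) : Sim 𝓗 L' a c :=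
  ⟨h.eq_iff, fun i n hn => h.br_eq i n (hn.trans_le hL), h.edge_iff⟩

theorem comp (h : Sim 𝓗 L a c) (g : ι' → ι) : Sim 𝓗 L (a ∘ g) (c ∘ g) :=
  ⟨fun i j => h.eq_iff (g i) (g j), fun i => h.br_eq (g i), fun v => h.edge_iff (g ∘ v)⟩

theorem of_embedding (hM : IsBase 𝓗 M) (g : M ↪[lang 𝓗] N) (L : ℕ) (a : ι → M) :
    Sim 𝓗 L a (g ∘ a) :=
  ⟨fun _ _ => g.injective.eq_iff.symm, fun i _ _ => by rw [Function.comp, map_br hM],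
    fun v => (map_edge g (v := a ∘ v)).symm⟩

end Sim

theorem IsBase.edge_perm_iff (hM : IsBase 𝓗 M) {v : Fin k → M} (σ : Equiv.Perm (Fin k)) :
    Edge 𝓗 (v ∘ σ) ↔ Edge 𝓗 v := by
  refine ⟨fun h => ?_, fun h => hM.symm h σ⟩
  simpa [Function.comp_assoc] using hM.symm h σ.symm

theorem IsBase.edge_cons_comp_perm (hM : IsBase 𝓗 M) {d : M} {w : Link k → M}
    (h : Edge 𝓗 (cons d w)) (τ : Equiv.Perm (Link k)) : Edge 𝓗 (cons d (w ∘ τ)) := by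
  have := hM.symm h (Equiv.Perm.ofSubtype τ)
  convert this using 1
  funext j
  by_cases hj : (j : ℕ) = 0
  · rw [Function.comp, Equiv.Perm.ofSubtype_apply_of_not_mem τ (by simpa using hj)]
    simp [cons, hj]
  · rw [Function.comp, Equiv.Perm.ofSubtype_apply_of_mem τ hj]
    simp [cons, hj, (τ ⟨j, hj⟩).2]

theorem injective_of_injective_cons {V : Type*} {d : V} {w : Link k → V}
    (h : Function.Injective (cons d w)) : Function.Injective w := by
  intro i j hij
  have : cons d w i = cons d w j := by simpa [cons, i.2, j.2] using hij
  exact Subtype.ext (h this)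

/-- By symmetry an edge through the added vertex may be rearranged to begin with it, so its links
decide all new edges. -/
theorem Sim.option {L : ℕ} {a : ι → M} {c : ι → N} (hM : IsBase 𝓗 M) (hN : IsBase 𝓗 N)
    (h : Sim 𝓗 L a c) {d : M} {d' : N} (heq : ∀ l, d = a l ↔ d' = c l)
    (hbr : ∀ n < L, br 𝓗 d n = br 𝓗 d' n)
    (hedge : ∀ u : Link k → ι, Edge 𝓗 (cons d (a ∘ u)) ↔ Edge 𝓗 (cons d' (c ∘ u))) :
    Sim 𝓗 L (fun o : Option ι => o.elim d a) (fun o : Option ι => o.elim d' c) := by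
  have hk : 0 < k := two_pos.trans_le 𝓗.two_le
  refine ⟨?_, ?_, fun v => ?_⟩
  · rintro (_ | i) (_ | j)
    · simp
    · exact heq j
    · exact eq_comm.trans ((heq i).trans eq_comm)
    · exact h.eq_iff i j
  · rintro (_ | i)
    · exact hbr
    · exact h.br_eq i
  · by_cases hv : Function.Injective v
    swap
    · exact iff_of_false (fun he => hv (Function.Injective.of_comp (hM.inj he)))
        (fun he => hv (Function.Injective.of_comp (hN.inj he)))
    by_cases hnone : ∃ j, v j = none
    · obtain ⟨j, hj⟩ := hnone
      let σ := Equiv.swap (⟨0, hk⟩ : Fin k) j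
      have h0 : ∀ l : Link k, ∃ i, v (σ l) = some i := by
        intro l
        rw [← Option.ne_none_iff_exists']
        intro hl
        have := σ.injective ((hv (hl.trans hj.symm)).trans (Equiv.swap_apply_left _ j).symm)
        exact l.2 (by rw [this])
      choose u hu using h0
      have hσ : v ∘ σ = cons none (some ∘ u) := by
        funext l
        by_cases hl : (l : ℕ) = 0
        · have hl' : l = ⟨0, hk⟩ := Fin.ext hl
          simp only [Function.comp, cons, hl, ne_eq, not_true, dite_false]
          rw [hl', Equiv.swap_apply_left, hj]
        · simp only [cons, hl, ne_eq, not_false_iff, dite_true, Function.comp]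
          exact hu ⟨l, hl⟩
      rw [← hM.edge_perm_iff σ, ← hN.edge_perm_iff σ, Function.comp_assoc, Function.comp_assoc,
        hσ, comp_cons, comp_cons]
      exact hedge u
    · push Not at hnone
      choose u hu using fun j => Option.ne_none_iff_exists'.1 (hnone j)
      obtain rfl : v = some ∘ u := funext hu
      exact h.edge_iff u

/-- One-point amalgamation of copies `c i` of `a` that meet only in constant positions. -/
theorem exists_sim_option (hM : IsBase 𝓗 M) (hN : N ⊨ modelTheory 𝓗) [Fintype ι] [Fintype I]
    [Nonempty I] {L : ℕ} {a : ι → M} {c : I → ι → N} (hc : ∀ i, Sim 𝓗 L a (c i))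
    (coh : ∀ i j l l', c i l = c j l' → c i l = c j l) {d : M}
    (hd : ∀ l, d = a l → ∀ i j, c i l = c j l) {D : Finset N}
    (hL : 𝓗.Large L (D.card + Fintype.card I * Fintype.card ι)) :
    ∃ d' : N, ((∀ l, d ≠ a l) → d' ∉ D) ∧ ∀ i,
      Sim 𝓗 L (fun o : Option ι => o.elim d a) (fun o : Option ι => o.elim d' (c i)) := by
  classical
  have hNb := isBase_of_modelTheory hN
  -- If `d` is an entry of `a`, that position is constant over the copies, and its common value
  -- serves.
  by_cases hda : ∃ l, d = a l
  · obtain ⟨l, rfl⟩ := hda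
    let i₀ := Classical.arbitrary I
    refine ⟨c i₀ l, fun h => absurd rfl (h l), fun i => ?_⟩
    rw [hd l rfl i₀ i]
    have := (hc i).comp (fun o : Option ι => o.elim l id)
    convert this using 1 <;> funext o <;> cases o <;> rfl
  push Not at hda
  let B : Finset N := D ∪ Finset.univ.image fun p : I × ι => c p.1 p.2
  have hcB : ∀ i l, c i l ∈ B := fun i l =>
    Finset.mem_union_right _ (Finset.mem_image.2 ⟨(i, l), Finset.mem_univ _, rfl⟩)
  have hB : B.card ≤ D.card + Fintype.card I * Fintype.card ι := by
    refine (Finset.card_union_le _ _).trans (Nat.add_le_add_left ?_ _)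
    exact Finset.card_image_le.trans (by simp)
  have hperm : ∀ w w' : Link k → N, Function.Injective w → Function.Injective w' →
      Set.range w = Set.range w' → ∃ τ : Equiv.Perm (Link k), w = w' ∘ τ := by
    intro w w' hw hw' h
    refine ⟨(Equiv.ofInjective w hw).trans ((Equiv.setCongr h).trans
      (Equiv.ofInjective w' hw').symm), ?_⟩
    funext j
    simp [Equiv.apply_ofInjective_symm hw']
  have hinj : ∀ i (u : Link k → ι), Edge 𝓗 (cons d (a ∘ u)) → Function.Injective (c i ∘ u) :=
    fun i u hu x y hxy => injective_of_injective_cons (hM.inj hu)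
      (((hc i).eq_iff _ _).2 hxy)
  -- Request the links of `d` over all copies simultaneously. Below `L` the copies have the branches
  -- of `a`, so the actual edges of `M` guarantee compatibility.
  obtain ⟨d', hd'B, hbr, hW⟩ := exists_vertex hN B
    {s | ∃ (i : I) (u : Link k → ι), s = Set.range (c i ∘ u) ∧ Edge 𝓗 (cons d (a ∘ u))} L
    (br 𝓗 d) (hL.mono le_rfl hB) (by
      rintro w hw - ⟨i, u, hs, hu⟩ n hn
      obtain ⟨τ, rfl⟩ := hperm _ _ hw (hinj i u hu) hs
      convert hM.edge (hM.edge_cons_comp_perm hu τ) n using 1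
      rw [show (fun j => br 𝓗 (cons d ((a ∘ u) ∘ τ) j) n) =
        cons (br 𝓗 d n) ((fun x => br 𝓗 x n) ∘ ((a ∘ u) ∘ τ)) from
        comp_cons (fun x => br 𝓗 x n) _ _]
      congr 1
      funext j
      exact ((hc i).br_eq _ n hn).symm)
  refine ⟨d', fun _ h => hd'B (Finset.mem_union_left _ h), fun i =>
    (hc i).option hM hNb (fun l => iff_of_false (hda l) fun h => hd'B (h ▸ hcB i l))
      (fun n hn => (hbr n hn).symm) fun u => ?_⟩
  by_cases hu : Function.Injective (c i ∘ u)
  swap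
  · exact iff_of_false (fun h => hu (hinj i u h))
      fun h => hu (injective_of_injective_cons (hNb.inj h))
  rw [hW _ hu fun j => hcB _ _]
  refine ⟨fun h => ⟨i, u, rfl, h⟩, ?_⟩
  -- A link requested for copy `j` may lie inside copy `i`. By `coh` the two copies agree there, so
  -- it comes from the same link in `a` and is wanted for `i` too.
  rintro ⟨j, u', hs, hu'⟩
  obtain ⟨τ, hτ⟩ := hperm _ _ hu (hinj j u' hu') hs
  have h1 : a ∘ u = (a ∘ u') ∘ τ := by
    funext x
    have h2 : c i (u x) = c j (u' (τ x)) := congrFun hτ x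
    have h3 := coh _ _ _ _ h2.symm
    exact ((hc i).eq_iff _ _).2 (h2.trans h3)
  rw [h1]
  exact hM.edge_cons_comp_perm hu' τ

/-- Amalgamation of copies `c i` of `a` that meet only in constant positions over `b`. -/
theorem exists_sim_sum (hM : IsBase 𝓗 M) (hN : N ⊨ modelTheory 𝓗) [Fintype I] [Nonempty I]
    {L m : ℕ} {b : Fin m → M} [Fintype ι] {a : ι → M} {c : I → ι → N}
    (hc : ∀ i, Sim 𝓗 L a (c i)) (coh : ∀ i j l l', c i l = c j l' → c i l = c j l)
    (hb : ∀ t l, b t = a l → ∀ i j, c i l = c j l)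
    (hL : 𝓗.Large L (Fintype.card I * (Fintype.card ι + m))) :
    ∃ b' : Fin m → N, ∀ i, Sim 𝓗 L (Sum.elim b a) (Sum.elim b' (c i)) := by
  induction m generalizing ι with
  | zero =>
    refine ⟨Fin.elim0, fun i => ?_⟩
    convert (hc i).comp (Sum.elim Fin.elim0 id) using 1 <;>
      · funext x
        rcases x with x | x
        · exact x.elim0
        · rfl
  | succ m ih =>
    obtain ⟨d', -, hd'⟩ := exists_sim_option hM hN hc coh (hb 0) (D := ∅)
      (hL.mono le_rfl (by
        rw [Finset.card_empty, zero_add]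
        exact Nat.mul_le_mul_left _ (Nat.le_add_right _ _)))
    -- The added vertex becomes a further entry, the same in all copies. If it equals another entry
    -- in one copy, it does so in every copy, so coherence persists.
    obtain ⟨b', hb'⟩ := ih (b := fun t => b t.succ) hd' (by
        rintro i j (_ | l) (_ | l') h
        · rfl
        · rfl
        · have h1 := (hd' j).eq_iff none (some l)
          have h2 := (hd' i).eq_iff none (some l)
          have h3 := h1.1 (h2.2 h.symm)
          exact h.trans h3
        · exact coh i j l l' h) (by
        rintro t (_ | l) h i j
        · rfl
        · exact hb t.succ l h i j) (hL.mono le_rfl (by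
        rw [Fintype.card_option]
        exact Nat.mul_le_mul_left _ (by omega)))
    refine ⟨Fin.cons d' b', fun i => ?_⟩
    convert (hb' i).comp (Sum.elim (Fin.cons (Sum.inr none) Sum.inl) (Sum.inr ∘ some)) using 1 <;>
      · funext x
        rcases x with x | x
        · refine Fin.cases ?_ (fun x => ?_) x <;> simp
        · rfl

/-! ### Quantifier elimination -/

theorem exists_eq_var {β : Type} (t : (lang 𝓗).Term β) : ∃ x, t = Term.var x := by
  cases t with
  | var x => exact ⟨x, rfl⟩
  | func f _ => exact nomatch f

end

/-- Quantifier elimination, in terms of finite approximations of types. -/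
theorem exists_level_boundedFormula {α : Type} [Fintype α] {n : ℕ}
    (φ : (lang 𝓗).BoundedFormula α n) :
    ∃ L, ∀ (M N : Type) [(lang 𝓗).Structure M] [(lang 𝓗).Structure N], M ⊨ modelTheory 𝓗 →
      N ⊨ modelTheory 𝓗 → ∀ (v : α → M) (xs : Fin n → M) (v' : α → N) (xs' : Fin n → N),
      Sim 𝓗 L (Sum.elim v xs) (Sum.elim v' xs') → (φ.Realize v xs ↔ φ.Realize v' xs') := by
  induction φ with
  | falsum => exact ⟨0, fun _ _ _ _ _ _ _ _ _ _ _ => Iff.rfl⟩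
  | equal t₁ t₂ =>
    obtain ⟨x, rfl⟩ := exists_eq_var t₁
    obtain ⟨y, rfl⟩ := exists_eq_var t₂
    exact ⟨0, fun _ _ _ _ _ _ _ _ _ _ h => h.eq_iff x y⟩
  | rel r ts =>
    choose x hx using fun i => exists_eq_var (ts i)
    obtain rfl := funext hx
    cases r with
    | R => exact ⟨0, fun _ _ _ _ _ _ _ _ _ _ h => h.edge_iff x⟩
    | Q η =>
      refine ⟨η.lgn, fun M N _ _ hM hN v xs v' xs' h => ?_⟩
      refine (relMap_symQ _).trans (Iff.trans ?_ (relMap_symQ _).symm)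
      rw [(isBase_of_modelTheory hM).pred, (isBase_of_modelTheory hN).pred]
      exact forall_congr' fun i => by
        simp only [Term.realize_var]
        rw [h.br_eq _ i i.2]
  | imp φ ψ ih₁ ih₂ =>
    obtain ⟨L₁, h₁⟩ := ih₁
    obtain ⟨L₂, h₂⟩ := ih₂
    refine ⟨max L₁ L₂, fun M N _ _ hM hN v xs v' xs' h => ?_⟩
    rw [BoundedFormula.realize_imp, BoundedFormula.realize_imp,
      h₁ M N hM hN v xs v' xs' (h.mono (le_max_left _ _)),
      h₂ M N hM hN v xs v' xs' (h.mono (le_max_right _ _))]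
  | @all n φ ih =>
    obtain ⟨L₁, h₁⟩ := ih
    obtain ⟨L₂, h₂⟩ := 𝓗.exists_large (Fintype.card (α ⊕ Fin n))
    have key : ∀ (M N : Type) [(lang 𝓗).Structure M] [(lang 𝓗).Structure N],
        M ⊨ modelTheory 𝓗 → N ⊨ modelTheory 𝓗 →
        ∀ (v : α → M) (xs : Fin n → M) (v' : α → N) (xs' : Fin n → N),
        Sim 𝓗 (max L₁ L₂) (Sum.elim v xs) (Sum.elim v' xs') →
        (φ.all.Realize v xs → φ.all.Realize v' xs') := by
      intro M N _ _ hM hN v xs v' xs' h hφ y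
      -- One back-and-forth step: amalgamation with a single copy pulls `y` back from `N` to `M`.
      obtain ⟨x, -, hx⟩ := exists_sim_option (I := Unit) (isBase_of_modelTheory hN) hM
        (fun _ => h.symm) (fun _ _ _ _ _ => rfl) (d := y) (fun _ _ _ _ => rfl) (D := ∅)
        (h₂.mono (le_max_right _ _) (by simp))
      refine (h₁ M N hM hN v (Fin.snoc xs x) v' (Fin.snoc xs' y) ?_).1 (hφ x)
      refine Sim.mono ?_ (le_max_left L₁ L₂)
      convert (hx ()).symm.comp (Sum.elim (some ∘ Sum.inl)
        (Fin.snoc (α := fun _ => Option (α ⊕ Fin n)) (some ∘ Sum.inr) none)) using 1 <;>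
      · funext z
        rcases z with z | z
        · rfl
        · refine Fin.lastCases ?_ (fun z => ?_) z <;> simp
    exact ⟨max L₁ L₂, fun M N _ _ hM hN v xs v' xs' h =>
      ⟨key M N hM hN v xs v' xs' h, key N M hN hM v' xs' v xs h.symm⟩⟩

theorem exists_level {α : Type} [Fintype α] (φ : (lang 𝓗).Formula α) :
    ∃ L, ∀ (M N : Type) [(lang 𝓗).Structure M] [(lang 𝓗).Structure N], M ⊨ modelTheory 𝓗 →
      N ⊨ modelTheory 𝓗 → ∀ (v : α → M) (v' : α → N),
      Sim 𝓗 L v v' → (φ.Realize v ↔ φ.Realize v') := by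
  obtain ⟨L, hL⟩ := exists_level_boundedFormula φ
  refine ⟨L, fun M N _ _ hM hN v v' h => hL M N hM hN v _ v' _ ?_⟩
  convert h.comp (Sum.elim id Fin.elim0) using 1 <;>
  · funext z
    rcases z with z | z
    · rfl
    · exact z.elim0

/-! ### The model completion -/

section

variable [(lang 𝓗).Structure M] [(lang 𝓗).Structure N]

/-- Embeddings between models of the model completion are elementary. -/
def toElementary (hM : M ⊨ modelTheory 𝓗) (hN : N ⊨ modelTheory 𝓗) (g : M ↪[lang 𝓗] N) :
    M ↪ₑ[lang 𝓗] N where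
  toFun := g
  map_formula' _ φ x := by
    obtain ⟨L, hL⟩ := exists_level φ
    exact (hL M N hM hN x _ (.of_embedding (isBase_of_modelTheory hM) g L x)).symm

end

theorem isModelCompletion_modelTheory (𝓗 : Template k) :
    ModelNotions.IsModelCompletion (baseTheory 𝓗) (modelTheory 𝓗) where
  extends_base φ hφ := Theory.models_sentence_of_mem (Or.inl hφ)
  embeds M := by
    have hM := isBase_of_model M.is_model
    have := Ext.model hM
    have : Nonempty (Ext 𝓗 M) := M.nonempty'.map Ext.base
    exact ⟨⟨Ext 𝓗 M⟩, ⟨Ext.inclusion hM⟩⟩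
  diagram_complete M N₁ N₂ f₁ f₂ φ := by
    classical
    have hM := isBase_of_model M.is_model
    -- The finitely many elements of `M` occurring in `φ` suffice, as levels are available for
    -- finitely many variables only.
    obtain ⟨L, hL⟩ := exists_level
      (BoundedFormula.restrictFreeVar φ (id : φ.freeVarFinset → φ.freeVarFinset))
    have h := hL N₁ N₂ N₁.is_model N₂.is_model (f₁ ∘ (↑)) (f₂ ∘ (↑))
      ((Sim.of_embedding hM f₁ L _).symm.trans (Sim.of_embedding hM f₂ L _))
    unfold Formula.Realize at h ⊢
    exact (BoundedFormula.realize_restrictFreeVar (f := id) f₁ fun _ => rfl).symm.trans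
      (h.trans (BoundedFormula.realize_restrictFreeVar (f := id) f₂ fun _ => rfl))

/-- The model completion is unique. -/
theorem model_of_isModelCompletion {T : (lang 𝓗).Theory}
    (hT : ModelNotions.IsModelCompletion (baseTheory 𝓗) T) (M : Theory.ModelType.{0, 0, 0} T) :
    M ⊨ modelTheory 𝓗 := by
  have base : ∀ N : Theory.ModelType.{0, 0, 0} T, N ⊨ baseTheory 𝓗 := fun N =>
    (Theory.model_iff _).2 fun φ hφ => (hT.extends_base φ hφ).realize_sentence N
  have hMb := base M
  have hM := isBase_of_model hMb
  have hE := Ext.model hM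
  have : Nonempty (Ext 𝓗 M) := M.nonempty'.map Ext.base
  have : Ext 𝓗 M ⊨ baseTheory 𝓗 := hE.mono Set.subset_union_left
  -- `M` sits in `Ext 𝓗 M`, which sits in a model `N` of `T`. The existential `extFormula` holds in
  -- `Ext 𝓗 M`, persists to `N`, and descends to `M` by completeness over the diagram of `M`.
  obtain ⟨N, ⟨f⟩⟩ := hT.embeds ⟨Ext 𝓗 M⟩
  let f' : Ext 𝓗 M ↪[lang 𝓗] N := f
  let g : M ↪[lang 𝓗] N := f'.comp (Ext.inclusion hM)
  have hg := hT.diagram_complete ⟨M⟩ N M g (Embedding.refl _ _)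
  have hN := isBase_of_model (base N)
  refine (Theory.model_iff _).2 ?_
  rintro φ (hφ | hφ)
  · exact (Theory.model_iff _).1 hMb φ hφ
  induction (hφ : ExtAxiom 𝓗 φ) with
  | mk m L s ν W large compat =>
  rw [realize_extAxiom]
  intro a ha hν
  have h1 := realize_extAxiom.1 ((Theory.model_iff _).1 hE _
    (Or.inr (ExtAxiom.mk m L s ν W large compat))) (Ext.inclusion hM ∘ a)
    ((Ext.inclusion hM).injective.comp ha) fun i => (map_pred _).2 (hν i)
  obtain ⟨x, hx, hs, hW⟩ := realize_extFormula.1 h1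
  have h2 : (extFormula m L s W).Realize default (g ∘ a) := by
    refine realize_extFormula.2 ⟨f' x, fun i h => hx i (f'.injective h), (map_pred _).2 hs,
      fun t ht => ?_⟩
    rw [← hW t ht, ← map_edge f', comp_cons]
    rfl
  have h3 : ∀ {P : Type} [(lang 𝓗).Structure P] (e : M → P),
      ((extFormula m L s W).toFormula.relabel (Sum.elim Empty.elim a)).Realize e ↔
        (extFormula m L s W).Realize default (e ∘ a) := by
    intro P _ e
    rw [Formula.realize_relabel, BoundedFormula.realize_toFormula]
    congr! 1
  exact (h3 _).1 ((hg _).1 ((h3 _).2 h2))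

/-! ### Amalgamation of formulas -/

/-- The level depends only on `φ` and the number `r` of copies, so similarity at one finite level is
enough wherever `r` is fixed in advance. -/
theorem exists_level_amalgam {m n : ℕ} (φ : (lang 𝓗).Formula (Fin m ⊕ Fin n)) (r : ℕ) :
    ∃ L, ∀ (M N : Type) [(lang 𝓗).Structure M] [(lang 𝓗).Structure N], M ⊨ modelTheory 𝓗 →
      N ⊨ modelTheory 𝓗 → ∀ (I : Type) [Fintype I] [Nonempty I], Fintype.card I = r →
      ∀ (b : Fin m → M) (a : Fin n → M) (c : I → Fin n → N), φ.Realize (Sum.elim b a) →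
      (∀ i, Sim 𝓗 L a (c i)) → (∀ i j l l', c i l = c j l' → c i l = c j l) →
      (∀ t l, b t = a l → ∀ i j, c i l = c j l) →
      ∃ b' : Fin m → N, ∀ i, φ.Realize (Sum.elim b' (c i)) := by
  obtain ⟨L₁, h₁⟩ := exists_level φ
  obtain ⟨L₂, h₂⟩ := 𝓗.exists_large (r * (n + m))
  refine ⟨max L₁ L₂, fun M N _ _ hM hN I _ _ hI b a c hφ hc coh hb => ?_⟩
  obtain ⟨b', hb'⟩ := exists_sim_sum (isBase_of_modelTheory hM) hN hc coh hb
    (h₂.mono (le_max_right _ _) (by rw [hI, Fintype.card_fin]))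
  exact ⟨b', fun i => (h₁ M N hM hN _ _ ((hb' i).mono (le_max_left _ _))).1 hφ⟩

section

variable [(lang 𝓗).Structure M] [(lang 𝓗).Structure N]

theorem sim_of_formulas (hM : IsBase 𝓗 M) (hN : IsBase 𝓗 N) {n : ℕ} {a : Fin n → M}
    {c : Fin n → N} (h : ∀ φ : (lang 𝓗).Formula (Fin n), φ.Realize a ↔ φ.Realize c) (L : ℕ) :
    Sim 𝓗 L a c := by
  refine ⟨fun i j => ?_, fun i => ?_, fun v => ?_⟩
  · have := h (Term.equal (Term.var i) (Term.var j))
    rwa [Formula.realize_equal, Formula.realize_equal] at this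
  · have := h ((symQ (cut (br 𝓗 (a i)) L)).formula fun _ => Term.var i)
    rw [Formula.realize_rel, Formula.realize_rel, relMap_symQ, relMap_symQ] at this
    have h2 := hN.pred_cut.1 (this.1 (hM.pred_cut.2 fun _ _ => rfl))
    exact fun n hn => (h2 n hn).symm
  · have := h ((symR 𝓗).formula fun j => Term.var (v j))
    rwa [Formula.realize_rel, Formula.realize_rel] at this

/-- Since `k ≥ 2`, a single vertex carries no edge, so its branch decides everything. -/
theorem sim_of_subsingleton {ι : Type} [Subsingleton ι] (hM : IsBase 𝓗 M) (hN : IsBase 𝓗 N)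
    {a : ι → M} {c : ι → N} (h : ∀ i, br 𝓗 (a i) = br 𝓗 (c i)) (L : ℕ) : Sim 𝓗 L a c := by
  have hv : ∀ v : Fin k → ι, ¬ Function.Injective v := fun v hv => by
    have := hv (Subsingleton.elim (v ⟨0, two_pos.trans_le 𝓗.two_le⟩) (v ⟨1, 𝓗.two_le⟩))
    simp at this
  exact ⟨fun i j => by simp [Subsingleton.elim i j], fun i n _ => by rw [h],
    fun v => iff_of_false (fun he => hv v (Function.Injective.of_comp (hM.inj he)))
      (fun he => hv v (Function.Injective.of_comp (hN.inj he)))⟩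

theorem exists_indiscernible_realization (hM : M ⊨ modelTheory 𝓗) {m n : ℕ}
    (φ : (lang 𝓗).Formula (Fin m ⊕ Fin n)) {I : Type} [LinearOrder I] [Infinite I]
    {a : I → Fin n → M} (ha : ModelNotions.IsIndiscernible (lang 𝓗) a) {i₀ : I} {b : Fin m → M}
    (hb : ∀ j l, b j ≠ a i₀ l) (hφ : φ.Realize (Sum.elim b (a i₀))) (S : Finset I) :
    ∃ b' : Fin m → M, ∀ i ∈ S, φ.Realize (Sum.elim b' (a i)) := by
  have hMb := isBase_of_modelTheory hM
  rcases S.eq_empty_or_nonempty with rfl | ⟨i₁, hi₁⟩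
  · exact ⟨b, by simp⟩
  have hsim : ∀ i j L, Sim 𝓗 L (a i) (a j) := fun i j => by
    refine sim_of_formulas hMb hMb fun ψ => ?_
    have := ha 1 (ψ.relabel fun x => (0, x)) (fun _ => i) (fun _ => j)
      (Subsingleton.strictMono _) (Subsingleton.strictMono _)
    rwa [Formula.realize_relabel, Formula.realize_relabel] at this
  have heq : ∀ {i j i' j' : I} {l l' : Fin n}, i < j → i' < j' → a i l = a j l' →
      a i' l = a j' l' := by
    intro i j i' j' l l' hij hij' h
    have := ha 2 (Term.equal (Term.var (0, l)) (Term.var (1, l'))) ![i, j] ![i', j']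
      (by simpa [Fin.strictMono_iff_lt_succ] using hij)
      (by simpa [Fin.strictMono_iff_lt_succ] using hij')
    rw [Formula.realize_equal, Formula.realize_equal] at this
    simpa using this.1 (by simpa using h)
  obtain ⟨p, q, s, hpq, hqs⟩ : ∃ p q s : I, p < q ∧ q < s := by
    obtain ⟨t, ht⟩ := Infinite.exists_subset_card_eq I 3
    let e := t.orderEmbOfFin ht
    exact ⟨e 0, e 1, e 2, e.strictMono (by decide), e.strictMono (by decide)⟩
  -- Compare two indices with a third lying on one side of both: each has an entry equal to the same
  -- entry there, so these entries are equal to each other.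
  have coh : ∀ i j l l', a i l = a j l' → a i l = a j l := by
    intro i j l l' h
    rcases lt_trichotomy i j with hij | rfl | hij
    · exact heq hpq hij ((heq hij (hpq.trans hqs) h).trans (heq hij hqs h).symm)
    · rfl
    · exact (heq hqs hij ((heq hij hpq h.symm).symm.trans (heq hij (hpq.trans hqs) h.symm))).symm
  obtain ⟨L, hL⟩ := exists_level_amalgam φ (Fintype.card S)
  have : Nonempty S := ⟨⟨i₁, hi₁⟩⟩
  obtain ⟨b', hb'⟩ := hL M M hM hM S rfl b (a i₀) (fun i => a i) hφ (fun i => hsim _ _ _)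
    (fun i j => coh i j) fun t l h => absurd h (hb t l)
  exact ⟨b', fun i hi => hb' ⟨i, hi⟩⟩

end

/-! ### Sequences of tuples along an ultrafilter -/

section

open Filter

variable {n : ℕ} {s : ℕ → Fin n → N}

/-- The `l`-th entry of the sequence `s` of tuples is constant along the ultrafilter. -/
def IsConst (s : ℕ → Fin n → N) (l : Fin n) : Prop := ∃ x, ∀ᶠ i in hyperfilter ℕ, s i l = x

theorem eventually_ne_of_not_isConst {l : Fin n} (h : ¬ IsConst s l) (x : N) :
    ∀ᶠ i in hyperfilter ℕ, s i l ≠ x :=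
  Ultrafilter.eventually_not.2 fun hx => h ⟨x, hx⟩

/-- A large set of tuples has finite subsets of any size whose elements meet in constant positions
only. -/
theorem exists_coherent (s : ℕ → Fin n → N) {P : ℕ → Prop} (hP : ∀ᶠ i in hyperfilter ℕ, P i)
    (r : ℕ) : ∃ S : Finset ℕ, S.card = r ∧ (∀ i ∈ S, P i) ∧
      (∀ i ∈ S, ∀ j ∈ S, ∀ l l', s i l = s j l' → s i l = s j l) ∧
      ∀ l, IsConst s l → ∀ i ∈ S, ∀ j ∈ S, s i l = s j l := by
  classical
  have hconst : ∀ᶠ i in hyperfilter ℕ,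
      ∀ l, ∀ x, (∀ᶠ i' in hyperfilter ℕ, s i' l = x) → s i l = x := by
    refine eventually_all.2 fun l => ?_
    by_cases hl : IsConst s l
    · obtain ⟨x, hx⟩ := hl
      filter_upwards [hx] with i hi y hy
      obtain ⟨i', h1, h2⟩ := (hx.and hy).exists
      exact hi.trans (h1.symm.trans h2)
    · exact Eventually.of_forall fun i x hx => absurd ⟨x, hx⟩ hl
  -- A non-constant entry almost always avoids the limit values of the constant ones.
  have hsep : ∀ᶠ i in hyperfilter ℕ, ∀ l l', ¬ IsConst s l →
      ∀ x, (∀ᶠ i' in hyperfilter ℕ, s i' l' = x) → s i l ≠ x := by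
    refine eventually_all.2 fun l => eventually_all.2 fun l' => ?_
    by_cases hl : IsConst s l
    · exact Eventually.of_forall fun i h => absurd hl h
    by_cases hl' : IsConst s l'
    · obtain ⟨x, hx⟩ := hl'
      filter_upwards [eventually_ne_of_not_isConst hl x] with i hi _ y hy
      obtain ⟨i', h1, h2⟩ := (hx.and hy).exists
      rwa [← h2, h1]
    · exact Eventually.of_forall fun i _ x hx => absurd ⟨x, hx⟩ hl'
  have key : ∃ S : Finset ℕ, S.card = r ∧ (∀ i ∈ S, P i ∧
      (∀ l, ∀ x, (∀ᶠ i' in hyperfilter ℕ, s i' l = x) → s i l = x) ∧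
      ∀ l l', ¬ IsConst s l → ∀ x, (∀ᶠ i' in hyperfilter ℕ, s i' l' = x) → s i l ≠ x) ∧
      ∀ i ∈ S, ∀ j ∈ S, i ≠ j → ∀ l l', s i l = s j l' → IsConst s l := by
    induction r with
    | zero => exact ⟨∅, by simp⟩
    | succ r ih =>
      obtain ⟨S, hS, hgood, hpair⟩ := ih
      have h1 : ∀ᶠ i in hyperfilter ℕ, i ∉ S :=
        hyperfilter_le_cofinite (Finset.finite_toSet S).compl_mem_cofinite
      have h2 : ∀ᶠ i in hyperfilter ℕ, ∀ j ∈ S, ∀ l l', ¬ IsConst s l → s i l ≠ s j l' := by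
        refine (eventually_all_finset S).2 fun j _ => eventually_all.2 fun l =>
          eventually_all.2 fun l' => ?_
        by_cases hl : IsConst s l
        · exact Eventually.of_forall fun i h => absurd hl h
        · filter_upwards [eventually_ne_of_not_isConst hl (s j l')] with i hi _ using hi
      obtain ⟨i, hiP, hi1, hi2, hiS, hi3⟩ :=
        (hP.and (hconst.and (hsep.and (h1.and h2)))).exists
      refine ⟨insert i S, by rw [Finset.card_insert_of_notMem hiS, hS], ?_, ?_⟩
      · intro j hj
        rcases Finset.mem_insert.1 hj with rfl | hj
        · exact ⟨hiP, hi1, hi2⟩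
        · exact hgood j hj
      · intro j hj j' hj' hne l l' h
        rcases Finset.mem_insert.1 hj with rfl | hjS <;>
          rcases Finset.mem_insert.1 hj' with rfl | hjS'
        · exact absurd rfl hne
        · by_contra hl
          exact hi3 j' hjS' l l' hl h
        -- The later tuple can meet the earlier one only in a constant entry, so the earlier entry
        -- equals a limit value and is itself constant.
        · obtain ⟨x, hx⟩ : IsConst s l' := by
            by_contra hl
            exact hi3 j hjS l' l hl h.symm
          by_contra hl
          exact (hgood j hjS).2.2 l l' hl x hx (h.trans (hi1 l' x hx))
        · exact hpair j hjS j' hjS' hne l l' h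
  obtain ⟨S, hS, hgood, hpair⟩ := key
  have hc : ∀ l, IsConst s l → ∀ i ∈ S, ∀ j ∈ S, s i l = s j l := by
    rintro l ⟨x, hx⟩ i hi j hj
    rw [(hgood i hi).2.1 l x hx, (hgood j hj).2.1 l x hx]
  refine ⟨S, hS, fun i hi => (hgood i hi).1, fun i hi j hj l l' h => ?_, hc⟩
  rcases eq_or_ne i j with rfl | hne
  · rfl
  · exact hc l (hpair i hi j hj hne l l' h) i hi j hj

theorem exists_eventually_eq {γ : Type*} [Finite γ] (g : ℕ → γ) :
    ∃ y, ∀ᶠ i in hyperfilter ℕ, g i = y := by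
  by_contra h
  push Not at h
  have h2 : ∀ᶠ i in hyperfilter ℕ, ∀ y, g i ≠ y :=
    eventually_all.2 h
  obtain ⟨i, hi⟩ := h2.exists
  exact hi _ rfl

/-- Up to level `L` a tuple has only finitely many possible configurations, so the ultrafilter
selects one. -/
theorem exists_eventually_sim [(lang 𝓗).Structure N] (s : ℕ → Fin n → N) (L : ℕ) :
    ∃ P : ℕ → Prop, (∀ᶠ i in hyperfilter ℕ, P i) ∧
      ∀ i j, P i → P j → Sim 𝓗 L (s i) (s j) := by
  obtain ⟨y, hy⟩ := exists_eventually_eq fun i =>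
    ((fun l l' => s i l = s i l', fun l n => br 𝓗 (s i l) n, fun v => Edge 𝓗 (s i ∘ v)) :
      (Fin n → Fin n → Prop) × (Fin n → ∀ n : Fin L, Fin (𝓗.H n)) × ((Fin k → Fin n) → Prop))
  refine ⟨_, hy, fun i j hi hj => ?_⟩
  have h := hi.trans hj.symm
  simp only [Prod.mk.injEq] at h
  exact ⟨fun l l' => iff_of_eq (congrFun (congrFun h.1 l) l'),
    fun l m hm => congrFun (congrFun h.2.1 l) ⟨m, hm⟩,
    fun v => iff_of_eq (congrFun h.2.2 v)⟩

end

/-! ### Dividing, simplicity and rank -/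

section

open ModelNotions Filter

variable [(lang 𝓗).Structure M] [(lang 𝓗).Structure N]

/-- Among the conjugates of `a` there are `r` that meet only in constant positions, and over these
the solution `b` amalgamates. -/
theorem not_divides (hM : M ⊨ modelTheory 𝓗) {m n : ℕ} (φ : (lang 𝓗).Formula (Fin m ⊕ Fin n))
    (A : Set M) {a : Fin n → M} {b : Fin m → M} (hb : ∀ j l, b j ≠ a l)
    (hφ : φ.Realize (Sum.elim b a)) : ¬ Divides A φ a := by
  rintro ⟨N, _, f, r, s, hs, hincon⟩
  have hN : N ⊨ modelTheory 𝓗 := (f.theory_model_iff _).1 hM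
  have hMb := isBase_of_modelTheory hM
  have hNb := isBase_of_modelTheory hN
  obtain ⟨L, hL⟩ := exists_level_amalgam φ r
  have hsim : ∀ i, Sim 𝓗 L a (s i) := fun i =>
    (Sim.of_embedding hMb f.toEmbedding L a).trans (sim_of_formulas hNb hNb (fun ψ => by
      have := hs i (ψ.relabel Sum.inr)
      rw [Formula.realize_relabel, Formula.realize_relabel] at this
      exact this.symm) L)
  obtain ⟨S, hS, -, coh, -⟩ := exists_coherent s (P := fun _ => True) (by simp) r
  refine hincon S hS ?_
  rcases S.eq_empty_or_nonempty with rfl | ⟨i₁, hi₁⟩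
  · exact ⟨f ∘ b, by simp⟩
  have : Nonempty S := ⟨⟨i₁, hi₁⟩⟩
  obtain ⟨b', hb'⟩ := hL M N hM hN S (by simpa using hS) b a (fun i => s i) hφ
    (fun i => hsim i) (fun i j => coh i i.2 j j.2) fun t l h => absurd h (hb t l)
  exact ⟨b', fun i hi => hb' ⟨i, hi⟩⟩

theorem not_hasTreeProperty (hM : M ⊨ modelTheory 𝓗) {m n : ℕ}
    (φ : (lang 𝓗).Formula (Fin m ⊕ Fin n)) : ¬ HasTreeProperty M φ := by
  rintro ⟨r, a, hbranch, hchild⟩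
  obtain ⟨L, hL⟩ := exists_level_amalgam φ r
  have hr : r ≠ 0 := by
    rintro rfl
    obtain ⟨b, -⟩ := hbranch (fun _ => 0) ∅
    exact hchild [] ∅ rfl ⟨b, by simp⟩
  -- For almost every child, each solution meets a non-constant entry; otherwise `r` coherent
  -- siblings would have a common solution.
  have hmoving : ∀ η, ∀ᶠ i in hyperfilter ℕ, ∀ b : Fin m → M,
      φ.Realize (Sum.elim b (a (η ++ [i]))) →
      ∃ t l, ¬ IsConst (fun i => a (η ++ [i])) l ∧ b t = a (η ++ [i]) l := by
    intro η
    obtain ⟨P, hP, hsim⟩ := exists_eventually_sim (𝓗 := 𝓗) (fun i => a (η ++ [i])) L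
    filter_upwards [hP] with i hi b hb
    by_contra hcon
    push Not at hcon
    obtain ⟨S, hS, hSP, coh, hconst⟩ := exists_coherent (fun i => a (η ++ [i])) hP r
    have : Nonempty S := (Finset.card_pos.1 (by omega)).to_subtype
    obtain ⟨b', hb'⟩ := hL M M hM hM S (by simpa using hS) b _ (fun j => a (η ++ [(j : ℕ)])) hb
      (fun j => hsim _ _ hi (hSP j j.2)) (fun i j => coh i i.2 j j.2) fun t l h i j =>
        hconst l (by_contra fun hl => hcon t l hl h) i i.2 j j.2
    exact hchild η S hS ⟨b', fun i hi => hb' ⟨i, hi⟩⟩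
  -- Choose such a child whose non-constant entries are moreover absent from all earlier nodes of
  -- the path.
  have hnext : ∀ η, ∃ i, (∀ b : Fin m → M, φ.Realize (Sum.elim b (a (η ++ [i]))) →
      ∃ t l, ¬ IsConst (fun i => a (η ++ [i])) l ∧ b t = a (η ++ [i]) l) ∧
      ∀ ν ∈ {ν | ν <+: η}, ∀ l l', ¬ IsConst (fun i => a (η ++ [i])) l →
        a (η ++ [i]) l ≠ a ν l' := by
    intro η
    have hfin : {ν | ν <+: η}.Finite := by
      refine (List.finite_toSet η.inits).subset fun ν hν => ?_
      exact (List.mem_inits ν η).2 hν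
    refine ((hmoving η).and ((eventually_all_finite hfin).2 fun ν _ => eventually_all.2 fun l =>
      eventually_all.2 fun l' => ?_)).exists
    by_cases hl : IsConst (fun i => a (η ++ [i])) l
    · exact Eventually.of_forall fun i h => absurd hl h
    · filter_upwards [eventually_ne_of_not_isConst hl (a ν l')] with i hi _ using hi
  choose next hnext₁ hnext₂ using hnext
  let p : ℕ → List ℕ := fun j => Nat.rec [] (fun _ η => η ++ [next η]) j
  have hp : ∀ j, p (j + 1) = p j ++ [next (p j)] := fun _ => rfl
  have hofFn : ∀ j, (List.ofFn fun i : Fin j => next (p i)) = p j := by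
    intro j
    induction j with
    | zero => rfl
    | succ j ih =>
      rw [List.ofFn_succ', List.concat_eq_append, hp, ← ih]
      simp [ih]
  have hprefix : ∀ i j, i ≤ j → p i <+: p j := by
    intro i j hij
    induction hij with
    | refl => exact List.prefix_rfl
    | step _ ih => exact ih.trans (List.prefix_append _ _)
  -- The root is not used; the `m + 1` nodes `p 1, …, p (m + 1)` outnumber the `m` coordinates of
  -- `b`.
  obtain ⟨b, hb⟩ := hbranch (fun j => next (p j)) (Finset.range (m + 2))
  have hb' : ∀ j : Fin (m + 1), ∃ t l, ¬ IsConst (fun i => a (p j ++ [i])) l ∧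
      b t = a (p (j + 1)) l := by
    intro j
    have := hb (j + 1) (Finset.mem_range.2 (by omega))
    rw [hofFn, hp] at this
    exact hnext₁ (p j) b this
  choose t l hl hbt using hb'
  obtain ⟨j, j', hne, ht⟩ := Fintype.exists_ne_map_eq_of_card_lt t (by simp)
  have key : ∀ j j' : Fin (m + 1), j < j' → t j ≠ t j' := by
    intro j j' hlt ht
    refine hnext₂ (p j') (p (j + 1)) (hprefix _ _ hlt) (l j') (l j) (hl j') ?_
    rw [← hp, ← hbt, ← hbt, ht]
  rcases lt_or_gt_of_ne hne with h | h
  · exact key _ _ h ht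
  · exact key _ _ h ht.symm

/-- An instance that is satisfied by an element of `A` does not divide over `A`. -/
theorem not_divides_of_mem {m n : ℕ} {A : Set M} {ψ : (lang 𝓗).Formula (Fin m ⊕ Fin n)}
    {b : Fin m → M} {c : Fin n → M} (hb : ∀ j, b j ∈ A) (hψ : ψ.Realize (Sum.elim b c)) :
    ¬ Divides A ψ c := by
  rintro ⟨N, _, f, r, s, hs, hincon⟩
  refine hincon (Finset.range r) (Finset.card_range r) ⟨f ∘ b, fun i _ => ?_⟩
  -- With `b` moved to the parameters, `ψ(b, y)` belongs to the type of `c` over `A`, so `b` solves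
  -- every conjugate instance.
  have := hs i (ψ.relabel (Sum.map (fun j => ⟨f (b j), Set.mem_image_of_mem f (hb j)⟩) id))
  simp only [Formula.realize_relabel, Sum.elim_comp_map, Function.comp_id] at this
  refine this.2 ?_
  have h := (f.map_formula ψ (Sum.elim b c)).2 hψ
  rwa [Sum.comp_elim] at h

theorem not_typeForks_of_mem {m : ℕ} {A B : Set M} {b : Fin m → M} (hb : ∀ j, b j ∈ A) :
    ¬ TypeForks (lang 𝓗) A B b := by
  rintro ⟨n, φ, a, -, hφ, N, _, f, l, p, ψ, c, hdiv, himp⟩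
  have h := (f.map_formula φ (Sum.elim b a)).2 hφ
  rw [Sum.comp_elim] at h
  obtain ⟨i, hi⟩ := himp _ h
  exact not_divides_of_mem (fun j => Set.mem_image_of_mem f (hb j)) hi (hdiv i)

/-- An analogue of `b` over `a` can be found outside all the parameters `c i`. It satisfies some `ψ
i`, which then does not divide by `not_divides`. -/
theorem not_typeForks_of_notMem (hM : M ⊨ modelTheory 𝓗) {A B : Set M} {b : Fin 1 → M}
    (hb : b 0 ∉ B) : ¬ TypeForks (lang 𝓗) A B b := by
  classical
  rintro ⟨n, φ, a, haB, hφ, N, _, f, l, p, ψ, c, hdiv, himp⟩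
  have hN : N ⊨ modelTheory 𝓗 := (f.theory_model_iff _).1 hM
  have hMb := isBase_of_modelTheory hM
  let D : Finset N := Finset.univ.biUnion fun i => Finset.univ.image (c i)
  obtain ⟨L₁, h₁⟩ := exists_level φ
  obtain ⟨L₂, h₂⟩ := 𝓗.exists_large (D.card + n)
  obtain ⟨d', hd'D, hd'⟩ := exists_sim_option (I := Unit) hMb hN (D := D) (d := b 0)
    (fun _ => Sim.of_embedding hMb f.toEmbedding (max L₁ L₂) a) (fun _ _ _ _ _ => rfl)
    (fun _ _ _ _ => rfl) (h₂.mono (le_max_right _ _) (by simp))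
  have hd'D := hd'D fun l h => hb (h ▸ haB l)
  have h : φ.Realize (Sum.elim (fun _ => d') (f ∘ a)) := by
    refine (h₁ M N hM hN (Sum.elim b a) _ ?_).1 hφ
    convert ((hd' ()).mono (le_max_left _ _)).comp (Sum.elim (fun _ => none) some) using 1
    · funext z
      rcases z with z | z
      · rw [Subsingleton.elim z 0]
        rfl
      · rfl
    · funext z
      rcases z with z | z <;> rfl
  obtain ⟨i, hi⟩ := himp _ h
  refine not_divides hN (ψ i) _ (fun _ l hl => hd'D ?_) hi (hdiv i)
  rw [hl]
  exact Finset.mem_biUnion.2 ⟨i, Finset.mem_univ _, Finset.mem_image_of_mem _ (Finset.mem_univ _)⟩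

/-- The first forking step puts the element into the base, after which no extension forks. -/
theorem not_suRankGE_two (hM : M ⊨ modelTheory 𝓗) (A : Set M) (b : Fin 1 → M) :
    ¬ SURankGE (lang 𝓗) 2 M A b := by
  rintro ⟨N, _, f, B, -, h₁, N', _, g, B', -, h₂, -⟩
  by_cases hb : f (b 0) ∈ B
  · refine not_typeForks_of_mem (fun j => ?_) h₂
    rw [Subsingleton.elim j 0]
    exact Set.mem_image_of_mem g hb
  · exact not_typeForks_of_notMem ((f.theory_model_iff _).1 hM) hb h₁

theorem divides_equal (hM : M ⊨ modelTheory 𝓗) (b : M) :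
    Divides (∅ : Set M) (Term.equal (Term.var (Sum.inl 0)) (Term.var (Sum.inr 0)) :
      (lang 𝓗).Formula (Fin 1 ⊕ Fin 1)) (fun _ => b) := by
  have hMb := isBase_of_modelTheory hM
  have hE := Ext.model hMb
  have hEb := isBase_of_modelTheory hE
  refine ⟨Ext 𝓗 M, inferInstance, toElementary hM hE (Ext.inclusion hMb), 2,
    -- Infinitely many vertices on the branch of `b`; the length `i` of the parameter tuple serves
    -- only to make them distinct.
    fun i _ => Ext.new (br 𝓗 b) i (fun _ => Ext.base b) ∅, fun i ψ => ?_, fun S hS => ?_⟩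
  · have : IsEmpty (toElementary hM hE (Ext.inclusion hMb) '' ∅) := by simp
    have := Fintype.ofFinite (toElementary hM hE (Ext.inclusion hMb) '' ∅ ⊕ Fin 1)
    have := (Equiv.emptySum (toElementary hM hE (Ext.inclusion hMb) '' ∅) (Fin 1)).subsingleton
    obtain ⟨L, hL⟩ := exists_level ψ
    refine hL _ _ hE hE _ _ (sim_of_subsingleton hEb hEb ?_ L)
    rintro (z | z)
    · exact isEmptyElim z
    · exact (Ext.br_eq_branch _).trans (Ext.br_eq_branch (Ext.base b)).symm
  · rintro ⟨x, hx⟩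
    obtain ⟨i, j, hij, rfl⟩ := Finset.card_eq_two.1 hS
    have h1 := hx i (by simp)
    have h2 := hx j (by simp)
    rw [Formula.realize_equal] at h1 h2
    have h3 := h1.symm.trans h2
    simp only [Term.realize_var, Sum.elim_inr] at h3
    injection h3 with _ h4
    exact hij h4

theorem suRankGE_one (hM : M ⊨ modelTheory 𝓗) (b : Fin 1 → M) :
    SURankGE (lang 𝓗) 1 M ∅ b := by
  have hb : b = fun _ => b 0 := funext fun j => by rw [Subsingleton.elim j 0]
  refine ⟨M, inferInstance, ElementaryEmbedding.refl _ _, {b 0}, by simp,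
    ⟨1, Term.equal (Term.var (Sum.inl 0)) (Term.var (Sum.inr 0)), fun _ => b 0, fun _ => rfl, ?_,
      M, inferInstance, ElementaryEmbedding.refl _ _, 1, fun _ => 1,
      fun _ => Term.equal (Term.var (Sum.inl 0)) (Term.var (Sum.inr 0)), fun _ _ => b 0,
      fun _ => ?_, fun x hx => ⟨0, hx⟩⟩, trivial⟩
  · rw [Formula.realize_equal]
    rfl
  · rw [Set.image_empty, Set.image_empty]
    exact divides_equal hM (b 0)

end

/-- Models are nonempty, so the embedding property needs a starting point: the free extension of the
empty structure, which contains vertices without parameters. -/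
theorem exists_model_of_isModelCompletion {T : (lang 𝓗).Theory}
    (hT : ModelNotions.IsModelCompletion (baseTheory 𝓗) T) :
    Nonempty (Theory.ModelType.{0, 0, 0} T) := by
  let _ : (lang 𝓗).Structure Empty := ⟨fun f => (nomatch f), fun _ _ => False⟩
  have h0 : IsBase 𝓗 Empty :=
    ⟨fun h => h.elim, fun h => h.elim, fun h => h.elim, fun {_ x} => x.elim⟩
  have : Ext 𝓗 Empty ⊨ baseTheory 𝓗 := (Ext.isBase h0).model
  have : Nonempty (Ext 𝓗 Empty) := ⟨.new (Classical.arbitrary _) 0 Fin.elim0 ∅⟩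
  obtain ⟨N, -⟩ := hT.embeds ⟨Ext 𝓗 Empty⟩
  exact ⟨N⟩

end HypergraphTemplate

theorem mainTheorem7 {k : ℕ} (𝓗 : HypergraphTemplate.Template k) :
    (∃ T : (HypergraphTemplate.lang 𝓗).Theory,
      ModelNotions.IsModelCompletion (HypergraphTemplate.baseTheory 𝓗) T) ∧
    ∀ T : (HypergraphTemplate.lang 𝓗).Theory,
      ModelNotions.IsModelCompletion (HypergraphTemplate.baseTheory 𝓗) T →
      ModelNotions.IsSimpleTheory T ∧
      ModelNotions.HasRankOne T ∧
      ∀ (M : Theory.ModelType.{0, 0, 0} T) (m n : ℕ)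
        (φ : (HypergraphTemplate.lang 𝓗).Formula (Fin m ⊕ Fin n)),
        (∀ (I : Type) [LinearOrder I] [Infinite I] (a : I → Fin n → M),
          ModelNotions.IsIndiscernible (HypergraphTemplate.lang 𝓗) a →
          ∀ (i₀ : I) (b : Fin m → M), (∀ j l, b j ≠ a i₀ l) →
            φ.Realize (Sum.elim b (a i₀)) →
            ∀ S : Finset I, ∃ b' : Fin m → M, ∀ i ∈ S, φ.Realize (Sum.elim b' (a i))) ∧
        ∀ (A : Set M) (a : Fin n → M) (b : Fin m → M), (∀ j l, b j ≠ a l) →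
          φ.Realize (Sum.elim b a) → ¬ ModelNotions.Divides A φ a := by
  open HypergraphTemplate in
  refine ⟨⟨_, isModelCompletion_modelTheory 𝓗⟩, fun T hT => ?_⟩
  have hmodel := model_of_isModelCompletion hT
  refine ⟨fun M m n φ => not_hasTreeProperty (hmodel M) φ,
    ⟨?_, fun M => not_suRankGE_two (hmodel M)⟩, fun M m n φ =>
      ⟨fun I _ _ a ha i₀ b hb hφ S => exists_indiscernible_realization (hmodel M) φ ha hb hφ S,
        fun A a b hb hφ => not_divides (hmodel M) φ A hb hφ⟩⟩
  obtain ⟨M⟩ := exists_model_of_isModelCompletion hT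
  exact ⟨M, ∅, fun _ => M.nonempty'.some, suRankGE_one (hmodel M) _⟩
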